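/- **Setting.** Let $L\ge 1$ and let $Y_0,Y_1,V,\Theta$ (real), $Z,\Gamma$ (in $\mathbb R^{L-1}$; absent if $L=1$) and $X$ (in $\mathbb R^k$) be random variables on a probability space. Put $\Delta=Y_1-Y_0$, $D=\mathbf 1\{V-Z'\Gamma-\Theta>0\}$, $Y=Y_0+\Delta D$, $\widetilde\Gamma=(\Gamma',\Theta)'$, $\widetilde S=(Z',1)'/\|(Z',1)\|$, $\widetilde V=V/\|(Z',1)\|$, $H^+=\{s\in\mathbb S^{L-1}:s_L>0\}$, $\mathrm{ATE}(x)=\mathbb E[\Delta|X=x]$. Assume: (A) for almost every $x$, the law of $(\widetilde S,\widetilde V,\widetilde\Gamma)$ given $X=x$ is absolutely continuous with respect to the product of the spherical measure on $\mathbb S^{L-1}$ and Lebesgue measure on $\mathbb R\times\mathbb R^L$; $(V,Z)\perp(Y_0,\Gamma,\Theta)\,|\,X$ and $(V,Z)\perp(Y_1,\Gamma,\Theta)\,|\,X$; $0<\mathbb P(D=1|X)<1$ a.s.; the values $X_0,X_1$ of $X$ when $D=0$, respectively $D=1$, satisfy $X_0=X_1$ a.s.; (B) $\mathbb E[Y_0^2+Y_1^2]<\infty$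 and $\mathbb E[Y_0\Delta|\Gamma,\Theta,X]=\mathbb E[Y_0|\Gamma,\Theta,X]\,\mathbb E[\Delta|\Gamma,\Theta,X]$. Large support condition (C): for almost every $x$, if $L=1$, $\mathrm{supp} f_{V|X}(\cdot|x)\supset\mathrm{supp} f_{\Theta|X}(\cdot|x)$; if $L\ge2$, $\mathrm{supp} f_{\widetilde S|X}(\cdot|x)=\overline{H^+}$ and, for almost every $s$ with respect to the law of $\widetilde S$ given $X=x$, $$\mathrm{supp} f_{\widetilde V|\widetilde S,X}(\cdot|s,x)\supset\Big[\inf_{\gamma\in\mathrm{supp} f_{\widetilde\Gamma|X}(\cdot|x)}s'\gamma,\ \sup_{\gamma\in\mathrm{supp} f_{\widetilde\Gamma|X}(\cdot|x)}s'\gamma\Big].$$ **Notation.** Regression functions given $X=x$ denote their continuous versions on the support of the regressors ($V$ if $L=1$, $(\widetilde S,\widetilde V)$ if $L\ge2$) given $X=x$; $\overline{\partial_v(\cdot)}$ is the derivative in the last regressor, extended by $0$ outside this support. $R[f](s,u)$ is the integral of $f\in L^1(\mathbb R^L)$ over the hyperplane $\{\gamma:s'\gamma=u\}$, and $R^{-1}[g]$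 is the (a.e. unique) $f\in L^1(\mathbb R^L)$ such that $R[f]=g$ for almost every $(s,u)\in H^+\times\mathbb R$. Where the conditional density in a denominator below is $0$, the numerator vanishes almost everywhere and the quotient is read as $0$. **Theorem.** Assume (A) and (B). 1. Let $L=1$. For almost every $x$, the continuous versions of $\mathbb E[Y^2|V=\cdot,X=x]$, $\mathbb E[Y|V=\cdot,X=x]$ and $\mathbb E[(1-2D)Y|V=\cdot,X=x]$ exist and are differentiable almost everywhere on $\mathrm{supp} f_{V|X}(\cdot|x)$, and for almost every $\theta\in\mathrm{supp} f_{V|X}(\cdot|x)$, $$\mathrm{Var}(\Delta|\Theta=\theta,X=x)f_{\Theta|X}(\theta|x)=\overline{\partial_v\mathbb E[Y^2|V=\cdot,X=x]}(\theta)+\frac{\overline{\partial_v\mathbb E[Y|V=\cdot,X=x]}(\theta)\ \overline{\partial_v\mathbb E[(1-2D)Y|V=\cdot,X=x]}(\theta)}{f_{\Theta|X}(\theta|x)}.$$ If (C) holds, this is true for almost every $\theta\in\mathbb R$, and $$\mathrm{Var}(\Delta|X=x)=\int_{\mathbb R}\mathrm{Var}(\Delta|\Theta=\theta,X=x)f_{\Theta|X}(\theta|x)\,d\theta+\int_{\mathbb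 R}\big(\mathbb E[\Delta|\Theta=\theta,X=x]-\mathrm{ATE}(x)\big)^2f_{\Theta|X}(\theta|x)\,d\theta,$$ where both integrands are integrable. 2. Let $L\ge2$ and let (C) hold. For almost every $x$, the continuous versions of $\mathbb E[Y^2|(\widetilde S,\widetilde V)=\cdot,X=x]$, $\mathbb E[Y|(\widetilde S,\widetilde V)=\cdot,X=x]$ and $\mathbb E[(1-2D)Y|(\widetilde S,\widetilde V)=\cdot,X=x]$ exist, at almost every $(s,v)\in H^+\times\mathbb R$ of the support they are differentiable in $v$, the extended derivatives lie in the range of $R$, and for almost every $\gamma\in\mathbb R^L$, $$\mathrm{Var}(\Delta|\widetilde\Gamma=\gamma,X=x)f_{\widetilde\Gamma|X}(\gamma|x)=R^{-1}\Big[\overline{\partial_v\mathbb E[Y^2|(\widetilde S,\widetilde V)=\cdot,X=x]}\Big](\gamma)+\frac{R^{-1}\Big[\overline{\partial_v\mathbb E[Y|(\widetilde S,\widetilde V)=\cdot,X=x]}\Big](\gamma)\ R^{-1}\Big[\overline{\partial_v\mathbb E[(1-2D)Y|(\widetilde S,\widetilde V)=\cdot,X=x]}\Big](\gamma)}{f_{\widetilde\Gamma|X}(\gamma|x)}.$$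 Moreover $$\mathrm{Var}(\Delta|X=x)=\int_{\mathbb R^L}\mathrm{Var}(\Delta|\widetilde\Gamma=\gamma,X=x)f_{\widetilde\Gamma|X}(\gamma|x)\,d\gamma+\int_{\mathbb R^L}\big(\mathbb E[\Delta|\widetilde\Gamma=\gamma,X=x]-\mathrm{ATE}(x)\big)^2f_{\widetilde\Gamma|X}(\gamma|x)\,d\gamma,$$ where both integrands are integrable. -/

import Mathlib

open MeasureTheory ProbabilityTheory Filter Topology

namespace TreatmentEffect

noncomputable section

/-- The Euclidean space `ℝⁿ`. -/
abbrev Euc (n : ℕ) : Type := EuclideanSpace ℝ (Fin n)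

/-- The vector `(z', a)'` of `ℝⁿ⁺¹`. -/
def snocVec {n : ℕ} (z : Euc n) (a : ℝ) : Euc (n + 1) :=
  WithLp.toLp 2 (Fin.snoc (α := fun _ => ℝ) (fun i => z i) a)

/-! ### Conditional means, variances, densities and conditional independence -/

section Conditioning

variable {Ω : Type*} [MeasurableSpace Ω] {𝒞 : Type*} [MeasurableSpace 𝒞]

/-- The conditional mean `E[W | C = c]`, through a regular conditional distribution. -/
def condMean (P : Measure Ω) [IsFiniteMeasure P] (W : Ω → ℝ) (C : Ω → 𝒞) (c : 𝒞) : ℝ :=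
  ∫ w, w ∂(condDistrib W C P c)

/-- The conditional variance `Var(W | C = c)`. -/
def condVariance (P : Measure Ω) [IsFiniteMeasure P] (W : Ω → ℝ) (C : Ω → 𝒞) (c : 𝒞) : ℝ :=
  variance (fun w : ℝ => w) (condDistrib W C P c)

/-- The conditional density `f_{U | C}(u | c)` with respect to Lebesgue measure. -/
def condDensity {𝒰 : Type*} [MeasureSpace 𝒰] [StandardBorelSpace 𝒰] [Nonempty 𝒰]
    (P : Measure Ω) [IsFiniteMeasure P] (U : Ω → 𝒰) (C : Ω → 𝒞) (c : 𝒞) (u : 𝒰) : ℝ :=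
  ((condDistrib U C P c).rnDeriv volume u).toReal

/-- `A` and `B` are independent conditionally on `C`: for almost every value `c` of `C`, the
conditional distribution of `(A, B)` given `C = c` is a product. -/
def CondIndepGiven {𝒜 ℬ : Type*} [MeasurableSpace 𝒜] [StandardBorelSpace 𝒜] [Nonempty 𝒜]
    [MeasurableSpace ℬ] [StandardBorelSpace ℬ] [Nonempty ℬ]
    (P : Measure Ω) [IsFiniteMeasure P] (A : Ω → 𝒜) (B : Ω → ℬ) (C : Ω → 𝒞) : Prop :=
  ∀ᵐ c ∂(P.map C), condDistrib (fun ω => (A ω, B ω)) C P c =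
    (condDistrib A C P c).prod (condDistrib B C P c)

end Conditioning

/-! ### Regression functions and their derivatives

A regression function is determined only up to null sets. As usual, it is understood as its
continuous version on the support of the law of the regressors, which is unique; it is
differentiated there, and the derivative is extended by `0` outside of that support. -/

section Regression

/-- `h` is a version of `g`, with respect to `ν`, that is continuous on the support of `ν`. -/
def IsContVersion {α : Type*} [TopologicalSpace α] [MeasurableSpace α] (ν : Measure α)
    (g h : α → ℝ) : Prop :=
  ContinuousOn h ν.support ∧ g =ᵐ[ν] h

open Classical in
/-- The continuous version of `g` on the support of `ν` (`0` if there is none). -/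
def contVersion {α : Type*} [TopologicalSpace α] [MeasurableSpace α] (ν : Measure α)
    (g : α → ℝ) : α → ℝ :=
  if H : ∃ h, IsContVersion ν g h then H.choose else 0

open Classical in
/-- Scalar regressor with law `ν`: the derivative of the continuous version of `g` on the
support of `ν`, extended by `0`. -/
def derivExt (ν : Measure ℝ) (g : ℝ → ℝ) (v : ℝ) : ℝ :=
  if v ∈ ν.support then derivWithin (contVersion ν g) ν.support v else 0

/-- Scalar regressor: `derivExt ν g` is a genuine derivative almost everywhere. -/
def HasDerivExt (ν : Measure ℝ) (g : ℝ → ℝ) : Prop :=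
  (∃ h, IsContVersion ν g h) ∧
    ∀ᵐ v : ℝ, v ∈ ν.support → DifferentiableWithinAt ℝ (contVersion ν g) ν.support v

variable {L : ℕ}

/-- The slice at `s` of the support of a law `ν` of `(S, V)`. -/
def slice (ν : Measure (Euc L × ℝ)) (s : Euc L) : Set ℝ := {v | (s, v) ∈ ν.support}

open Classical in
/-- Regressors `(S, V)` with law `ν`: the derivative in `v` of the continuous version of `g` on
the support of `ν`, extended by `0`. -/
def partialExt (ν : Measure (Euc L × ℝ)) (g : Euc L × ℝ → ℝ) (s : Euc L) (v : ℝ) : ℝ :=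
  if v ∈ slice ν s then derivWithin (fun w => contVersion ν g (s, w)) (slice ν s) v else 0

end Regression

/-! ### The Radon transform -/

section Radon

variable {L : ℕ}

/-- The spherical measure, seen as a measure on the ambient space carried by the unit sphere. -/
def sphereMeasure (L : ℕ) : Measure (Euc L) :=
  (volume : Measure (Euc L)).toSphere.map Subtype.val

/-- The open upper half `H⁺` of the unit sphere of `ℝⁿ⁺¹`. -/
def upperHemisphere (n : ℕ) : Set (Euc (n + 1)) := {s | ‖s‖ = 1 ∧ 0 < s (Fin.last n)}

/-- The Radon transform: the integral of `f` over the hyperplane `{γ | ⟪s, γ⟫ = u}`, for a unit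
vector `s`, with respect to the Lebesgue measure of that hyperplane. -/
def radon (f : Euc L → ℝ) (s : Euc L) (u : ℝ) : ℝ :=
  ∫ y : (Submodule.span ℝ {s})ᗮ, f (u • s + (y : Euc L))

/-- The integrable function `f` has Radon transform `g`, almost everywhere on `H⁺ × ℝ`. -/
def IsRadonPreimage {n : ℕ} (g : Euc (n + 1) → ℝ → ℝ) (f : Euc (n + 1) → ℝ) : Prop :=
  Integrable f ∧
    ∀ᵐ s ∂((sphereMeasure (n + 1)).restrict (upperHemisphere n)), ∀ᵐ u : ℝ, radon f s u = g s u

/-- `g` is in the range of the Radon transform on `L¹`. -/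
def InRadonRange {n : ℕ} (g : Euc (n + 1) → ℝ → ℝ) : Prop := ∃ f, IsRadonPreimage g f

open Classical in
/-- The inverse Radon transform `R⁻¹[g]`: the function in `L¹`, unique almost everywhere, whose
Radon transform is `g` (and `0` if `g` is not in the range). -/
def radonInv {n : ℕ} (g : Euc (n + 1) → ℝ → ℝ) : Euc (n + 1) → ℝ :=
  if H : InRadonRange g then H.choose else 0

/-- Regressors `(S, V)` with law `ν`: `partialExt ν g` is a genuine partial derivative almost
everywhere on `H⁺ × ℝ`. -/
def HasPartialExt {n : ℕ} (ν : Measure (Euc (n + 1) × ℝ)) (g : Euc (n + 1) × ℝ → ℝ) : Prop :=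
  (∃ h, IsContVersion ν g h) ∧
    ∀ᵐ s ∂((sphereMeasure (n + 1)).restrict (upperHemisphere n)), ∀ᵐ v : ℝ, v ∈ slice ν s →
      DifferentiableWithinAt ℝ (fun w => contVersion ν g (s, w)) (slice ν s) v

end Radon

/-! ### The model -/

/-- The primitive random variables: potential outcomes `Y0, Y1`, instruments `(V, Z')` in
`ℝⁿ⁺¹`, unobserved coefficients `(Γ', Θ)` in `ℝⁿ⁺¹`, and the values `X0, X1` that the vector of
covariates takes without and with treatment. The dimension `L` of the instruments is `n + 1`; for
`L = 1` the variables `Z` and `Γ` carry no information. -/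
structure Model (Ω : Type*) [MeasurableSpace Ω] (n k : ℕ) where
  Y0 : Ω → ℝ
  Y1 : Ω → ℝ
  V : Ω → ℝ
  Z : Ω → Euc n
  Γ : Ω → Euc n
  Θ : Ω → ℝ
  X0 : Ω → Euc k
  X1 : Ω → Euc k
  measurable_Y0 : Measurable Y0
  measurable_Y1 : Measurable Y1
  measurable_V : Measurable V
  measurable_Z : Measurable Z
  measurable_Γ : Measurable Γ
  measurable_Θ : Measurable Θ
  measurable_X0 : Measurable X0
  measurable_X1 : Measurable X1

namespace Model

variable {Ω : Type*} [MeasurableSpace Ω] {n k : ℕ} (M : Model Ω n k)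

open Classical in
/-- The treatment `D = 1{V - Z'Γ - Θ > 0}`. -/
def D (ω : Ω) : ℝ := if M.V ω - inner ℝ (M.Z ω) (M.Γ ω) - M.Θ ω > 0 then 1 else 0

/-- The treatment effect `Δ = Y1 - Y0`. -/
def Δ (ω : Ω) : ℝ := M.Y1 ω - M.Y0 ω

/-- The observed outcome `Y = Y0 + Δ D`. -/
def Y (ω : Ω) : ℝ := M.Y0 ω + M.Δ ω * M.D ω

open Classical in
/-- The observed covariates. -/
def X (ω : Ω) : Euc k := if M.D ω = 1 then M.X1 ω else M.X0 ω

/-- The rescaled instrument `S̃ = (Z', 1)' / ‖(Z', 1)‖`. -/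
def S (ω : Ω) : Euc (n + 1) := ‖snocVec (M.Z ω) 1‖⁻¹ • snocVec (M.Z ω) 1

/-- The rescaled instrument `Ṽ = V / ‖(Z', 1)‖`. -/
def Vt (ω : Ω) : ℝ := M.V ω / ‖snocVec (M.Z ω) 1‖

/-- The pair `(S̃, Ṽ)`. -/
def SV (ω : Ω) : Euc (n + 1) × ℝ := (M.S ω, M.Vt ω)

/-- The vector of unobservables `Γ̃ = (Γ', Θ)'`. -/
def Γt (ω : Ω) : Euc (n + 1) := snocVec (M.Γ ω) (M.Θ ω)

variable (P : Measure Ω) [IsProbabilityMeasure P]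

/-- The basic assumptions of the model. -/
structure BasicAssumptions : Prop where
  /-- Given `X = x`, the law of `(S̃, Ṽ, Γ̃)` is absolutely continuous. -/
  abs_cont : ∀ᵐ x ∂(P.map M.X),
    condDistrib (fun ω => ((M.S ω, M.Vt ω), M.Γt ω)) M.X P x ≪
      ((sphereMeasure (n + 1)).prod (volume : Measure ℝ)).prod (volume : Measure (Euc (n + 1)))
  /-- `(V, Z)` is independent of `(Y0, Γ, Θ)` given `X`. -/
  indep_Y0 : CondIndepGiven P (fun ω => (M.V ω, M.Z ω))
    (fun ω => (M.Y0 ω, M.Γ ω, M.Θ ω)) M.X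
  /-- `(V, Z)` is independent of `(Y1, Γ, Θ)` given `X`. -/
  indep_Y1 : CondIndepGiven P (fun ω => (M.V ω, M.Z ω))
    (fun ω => (M.Y1 ω, M.Γ ω, M.Θ ω)) M.X
  /-- `0 < P(D = 1 | X) < 1` almost surely. -/
  overlap : ∀ᵐ ω ∂P,
    0 < (P[M.D | MeasurableSpace.comap M.X inferInstance]) ω ∧
      (P[M.D | MeasurableSpace.comap M.X inferInstance]) ω < 1
  /-- The covariates are not caused by the treatment. -/
  exog_X : M.X0 =ᵐ[P] M.X1

/-- The σ-algebra generated by `(Γ, Θ, X)`. -/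
abbrev sigmaUnobs : MeasurableSpace Ω :=
  MeasurableSpace.comap (fun ω => (M.Γ ω, M.Θ ω, M.X ω)) inferInstance

/-- Finite second moments, and `Y0` and `Δ` are uncorrelated given `(Γ, Θ, X)`. -/
structure Uncorrelated : Prop where
  second_moments : Integrable (fun ω => M.Y0 ω ^ 2 + M.Y1 ω ^ 2) P
  uncorr : P[fun ω => M.Y0 ω * M.Δ ω | M.sigmaUnobs] =ᵐ[P]
    fun ω => (P[M.Y0 | M.sigmaUnobs]) ω * (P[M.Δ | M.sigmaUnobs]) ω

/-- Large support for `L = 1`: the support of `V` given `X = x` contains that of `Θ`. -/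
def LargeSupportScalar : Prop :=
  ∀ᵐ x ∂(P.map M.X), (condDistrib M.Θ M.X P x).support ⊆ (condDistrib M.V M.X P x).support

/-- Large support for `L ≥ 2`: given `X = x`, the support of `S̃` is the closed upper hemisphere,
and given `S̃ = s` and `X = x`, the support of `Ṽ` contains all the real numbers between the
infimum and the supremum (possibly infinite) of `⟪s, γ⟫` over `γ` in the support of `Γ̃` given
`X = x`. -/
def LargeSupportVector : Prop :=
  ∀ᵐ x ∂(P.map M.X),
    (condDistrib M.S M.X P x).support = closure (upperHemisphere n) ∧
    ∀ᵐ s ∂(condDistrib M.S M.X P x),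
      {v : ℝ | (⨅ γ ∈ (condDistrib M.Γt M.X P x).support, ((inner ℝ s γ : ℝ) : EReal)) ≤ v ∧
          (v : EReal) ≤ ⨆ γ ∈ (condDistrib M.Γt M.X P x).support, ((inner ℝ s γ : ℝ) : EReal)} ⊆
        (condDistrib M.Vt (fun ω => (M.S ω, M.X ω)) P (s, x)).support

/-- `∂_v E[W | V = ·, X = x]`, extended by `0` outside the support of `V` given `X = x`. -/
def dvScalar (W : Ω → ℝ) (x : Euc k) : ℝ → ℝ :=
  derivExt (condDistrib M.V M.X P x)
    (fun v => condMean P W (fun ω => (M.V ω, M.X ω)) (v, x))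

/-- The derivative in `dvScalar` exists. -/
def DvScalarExists (W : Ω → ℝ) (x : Euc k) : Prop :=
  HasDerivExt (condDistrib M.V M.X P x)
    (fun v => condMean P W (fun ω => (M.V ω, M.X ω)) (v, x))

/-- `∂_v E[W | (S̃, Ṽ) = ·, X = x]`, extended by `0` outside the support of `(S̃, Ṽ)` given
`X = x`. -/
def dvVector (W : Ω → ℝ) (x : Euc k) : Euc (n + 1) → ℝ → ℝ :=
  partialExt (condDistrib M.SV M.X P x)
    (fun p => condMean P W (fun ω => (M.SV ω, M.X ω)) (p, x))

/-- The derivative in `dvVector` exists. -/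
def DvVectorExists (W : Ω → ℝ) (x : Euc k) : Prop :=
  HasPartialExt (condDistrib M.SV M.X P x)
    (fun p => condMean P W (fun ω => (M.SV ω, M.X ω)) (p, x))

/-- The squared outcome `Y²`. -/
def Ysq (ω : Ω) : ℝ := M.Y ω ^ 2

/-- The signed outcome `(1 - 2D) Y`. -/
def Ysigned (ω : Ω) : ℝ := (1 - 2 * M.D ω) * M.Y ω

/-- The average treatment effect `ATE(x) = E[Δ | X = x]`. -/
def ATE (x : Euc k) : ℝ := condMean P M.Δ M.X x

/-- For `L = 1`: the identity for `Var(Δ | Θ = θ, X = x) f_{Θ|X}(θ | x)`. -/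
def VarianceFormulaScalar (x : Euc k) (θ : ℝ) : Prop :=
  condVariance P M.Δ (fun ω => (M.Θ ω, M.X ω)) (θ, x) * condDensity P M.Θ M.X x θ =
    M.dvScalar P M.Ysq x θ +
      M.dvScalar P M.Y x θ * M.dvScalar P M.Ysigned x θ / condDensity P M.Θ M.X x θ

/-- For `L ≥ 2`: the identity for `Var(Δ | Γ̃ = γ, X = x) f_{Γ̃|X}(γ | x)`. -/
def VarianceFormulaVector (x : Euc k) (γ : Euc (n + 1)) : Prop :=
  condVariance P M.Δ (fun ω => (M.Γt ω, M.X ω)) (γ, x) * condDensity P M.Γt M.X x γ =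
    radonInv (M.dvVector P M.Ysq x) γ +
      radonInv (M.dvVector P M.Y x) γ * radonInv (M.dvVector P M.Ysigned x) γ /
        condDensity P M.Γt M.X x γ

/-- The decomposition of `Var(Δ | X = x)` along unobservables `U` with a conditional density. -/
def VarianceDecomposition {𝒰 : Type*} [MeasureSpace 𝒰] [StandardBorelSpace 𝒰] [Nonempty 𝒰]
    (U : Ω → 𝒰) (x : Euc k) : Prop :=
  Integrable (fun u => condVariance P M.Δ (fun ω => (U ω, M.X ω)) (u, x) *
      condDensity P U M.X x u) ∧
  Integrable (fun u => (condMean P M.Δ (fun ω => (U ω, M.X ω)) (u, x) - M.ATE P x) ^ 2 *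
      condDensity P U M.X x u) ∧
  condVariance P M.Δ M.X x =
    (∫ u, condVariance P M.Δ (fun ω => (U ω, M.X ω)) (u, x) * condDensity P U M.X x u) +
      ∫ u, (condMean P M.Δ (fun ω => (U ω, M.X ω)) (u, x) - M.ATE P x) ^ 2 *
        condDensity P U M.X x u

end Model

end

end TreatmentEffect

open TreatmentEffect

/-! Fix `x` and work under the law of the primitives given `X = x`. Write `f` for the density of the
unobservable `Γ̃`. The observed outcomes `Y²`, `Y`, `(1 - 2D)Y` all have the form `φ₁(Y₁)` if `D =
1` and `φ₀(Y₀)` if `D = 0`, with `(φ₀, φ₁)` equal to `(y², y²)`, `(y, y)`, `(y, -y)`. Since `D = 1`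
means `⟪S̃, Γ̃⟫ < Ṽ`, independence of the instruments turns the regression function at `(s, v)` into
`E[φ₀(Y₀)] + ∫_{⟪s,γ⟫ < v} g(γ) dγ`, where `g = (E[φ₁(Y₁)|γ] - E[φ₀(Y₀)|γ]) f(γ)` (`effectDensity`,
`condMean_of_indepFun`).

Slicing the half-space by hyperplanes, the integral is `∫_{-∞}^v R[g](s,u) du`. It is continuous, so
it gives the continuous version of the regression, and by Lebesgue differentiation its derivative in
`v` is `R[g](s,v)` for almost every `v`. Outside the support of the regressors the extended
derivative is `0`, and large support makes `R[g]` vanish there too (`isRadonPreimage_partialExt`).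
The Radon transform is injective on `L¹` by the Fourier slice theorem (`ae_eq_of_radon_ae_eq`), so
`R⁻¹` returns `g`. For `L = 1` the half-space is a half-line and the derivative is `g` itself.

It remains to combine the three functions `g`. From `Δ² = Y₁² - Y₀² - 2Y₀Δ` and `E[Y₀Δ|γ] =
E[Y₀|γ]E[Δ|γ]`, `Var(Δ|γ) = E[Y₁² - Y₀²|γ] - E[Δ|γ] E[Y₀ + Y₁|γ]`, and multiplication by `f` gives
the formula (`condVariance_sub_ae_eq`). The decomposition of `Var(Δ|X = x)` is the law of total
variance. Passing between the law given `X = x` and the original probability rests on the tower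
property of conditional distributions (`condDistrib_condDistrib_ae_eq`). -/

section RadonTransform

/-! ### Slicing by hyperplanes and injectivity of the Radon transform -/

variable {L : ℕ}

lemma measurePreserving_smul_add_orthogonal {s : Euc L} (hs : ‖s‖ = 1) :
    MeasurePreserving (fun p : ℝ × (Submodule.span ℝ {s})ᗮ => p.1 • s + (p.2 : Euc L))
      ((volume : Measure ℝ).prod volume) volume := by
  let e := LinearIsometryEquiv.toSpanUnitSingleton (𝕜 := ℝ) s hs
  have h1 : MeasurePreserving (Prod.map e (id : (Submodule.span ℝ {s})ᗮ → _))
      ((volume : Measure ℝ).prod volume) (volume.prod volume) :=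
    e.measurePreserving.prod (MeasurePreserving.id _)
  have h2 := ((Submodule.span ℝ {s}).orthogonalDecomposition.symm.measurePreserving.comp
    (WithLp.volume_preserving_toLp (Submodule.span ℝ {s}) ((Submodule.span ℝ {s})ᗮ))).comp h1
  convert! h2 using 1

lemma inner_smul_add_orthogonal {s : Euc L} (hs : ‖s‖ = 1) (u : ℝ)
    (y : (Submodule.span ℝ {s})ᗮ) : inner ℝ s (u • s + (y : Euc L)) = u := by
  have : inner ℝ s (y : Euc L) = 0 :=
    (Submodule.mem_orthogonal_singleton_iff_inner_right).1 y.2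
  rw [inner_add_right, inner_smul_right, this, real_inner_self_eq_norm_sq, hs]; simp

lemma integrable_radon {s : Euc L} (hs : ‖s‖ = 1) {g : Euc L → ℝ} (hg : Integrable g) :
    Integrable (radon g s) := by
  have := (measurePreserving_smul_add_orthogonal hs).integrable_comp_of_integrable hg
  exact this.integral_prod_left

/-- Fubini along `ℝs ⊕ s^⊥`. It is used with `φ` a complex exponential, for the Fourier slice
theorem, and with `φ` the indicator of a half-line, for integrals over half-spaces. -/
lemma integral_smul_comp_inner {E : Type*} [NormedAddCommGroup E] [NormedSpace ℝ E]
    [CompleteSpace E]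
    {s : Euc L} (hs : ‖s‖ = 1) {g : Euc L → ℝ} (φ : ℝ → E)
    (h : Integrable fun γ => g γ • φ (inner ℝ s γ)) :
    ∫ γ, g γ • φ (inner ℝ s γ) = ∫ u, radon g s u • φ u := by
  have hmp := measurePreserving_smul_add_orthogonal hs
  have hae : AEStronglyMeasurable (fun γ => g γ • φ (inner ℝ s γ)) (Measure.map
    (fun p : ℝ × (Submodule.span ℝ {s})ᗮ => p.1 • s + (p.2 : Euc L))
      ((volume : Measure ℝ).prod volume)) := by rw [hmp.map_eq]; exact h.1
  rw [← hmp.map_eq, integral_map hmp.measurable.aemeasurable hae, integral_prod]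
  · refine integral_congr_ae (ae_of_all _ fun u => ?_)
    simp only [inner_smul_add_orthogonal hs]
    rw [integral_smul_const]; rfl
  · exact hmp.integrable_comp_of_integrable h

lemma radon_ae_eq_zero {s : Euc L} (hs : ‖s‖ = 1) {g : Euc L → ℝ} {B : Set ℝ}
    (h : ∀ᵐ γ : Euc L, inner ℝ s γ ∈ B → g γ = 0) :
    ∀ᵐ u : ℝ, u ∈ B → radon g s u = 0 := by
  have hmp := measurePreserving_smul_add_orthogonal hs
  have := Measure.ae_ae_of_ae_prod (hmp.quasiMeasurePreserving.ae h)
  filter_upwards [this] with u hu huB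
  simp only [inner_smul_add_orthogonal hs] at hu
  exact integral_eq_zero_of_ae (hu.mono fun y hy => hy huB)

lemma isOpen_setOf_last_pos (n : ℕ) : IsOpen {s : Euc (n + 1) | 0 < s (Fin.last n)} :=
  isOpen_lt continuous_const (PiLp.continuous_apply 2 _ _)

lemma measurableSet_upperHemisphere (n : ℕ) : MeasurableSet (upperHemisphere n) :=
  MeasurableSet.inter (measurable_norm (measurableSet_singleton 1))
    (isOpen_setOf_last_pos n).measurableSet

/-- The spherical measure charges every nonempty open set, so a property true almost everywhere on
the hemisphere holds on a dense subset of it. -/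
lemma frequently_upperHemisphere {n : ℕ} {p : Euc (n + 1) → Prop}
    (hp : ∀ᵐ s ∂((sphereMeasure (n + 1)).restrict (upperHemisphere n)), p s)
    {s₀ : Euc (n + 1)} (hs₀ : s₀ ∈ upperHemisphere n) :
    ∃ᶠ s in 𝓝 s₀, s ∈ upperHemisphere n ∧ p s := by
  rw [ae_restrict_iff' (measurableSet_upperHemisphere n), sphereMeasure] at hp
  replace hp := ae_of_ae_map measurable_subtype_coe.aemeasurable hp
  rw [Filter.frequently_iff]
  intro N hN
  by_contra! hcon
  obtain ⟨N', hN', hNo, hs₀N⟩ := mem_nhds_iff.1 hN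
  let O : Set (Metric.sphere (0 : Euc (n + 1)) 1) :=
    Subtype.val ⁻¹' (N' ∩ {s : Euc (n + 1) | 0 < s (Fin.last n)})
  have hO : IsOpen O := (hNo.inter (isOpen_setOf_last_pos n)).preimage continuous_subtype_val
  have hpos : 0 < (volume : Measure (Euc (n + 1))).toSphere O :=
    hO.measure_pos _ ⟨⟨s₀, by simpa using hs₀.1⟩, hs₀N, hs₀.2⟩
  refine hpos.ne' (measure_mono_null ?_ hp)
  rintro ⟨s, hs⟩ ⟨h1, h2⟩ h3
  have hsH : s ∈ upperHemisphere n := ⟨by simpa using hs, h2⟩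
  exact hcon s (hN' h1) hsH (h3 hsH)

lemma integrable_smul_exp_inner {g : Euc L → ℝ} (hg : Integrable g) (ξ : Euc L) :
    Integrable fun γ => g γ • Complex.exp (inner ℝ γ ξ * Complex.I) := by
  refine (hg.norm).mono' (hg.1.smul (Continuous.aestronglyMeasurable (by fun_prop))) ?_
  exact ae_of_all _ fun γ => by rw [norm_smul, Complex.norm_exp_ofReal_mul_I, mul_one]

/-- The finite measures with densities `g⁺` and `g⁻` have the same characteristic function, hence
coincide, so `g⁺ = g⁻` almost everywhere. -/
lemma ae_eq_zero_of_integral_smul_exp_inner_eq_zero {g : Euc L → ℝ} (hg : Integrable g)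
    (h : ∀ ξ : Euc L, ∫ γ, g γ • Complex.exp (inner ℝ γ ξ * Complex.I) = 0) : g =ᵐ[volume] 0 := by
  have aux : ∀ f : Euc L → ℝ, Integrable f →
      IsFiniteMeasure (volume.withDensity fun γ => ENNReal.ofReal (f γ)) := fun f hf =>
    isFiniteMeasure_withDensity_ofReal hf.2
  have hchar : ∀ f : Euc L → ℝ, Integrable f → ∀ ξ,
      charFun (volume.withDensity fun γ => ENNReal.ofReal (f γ)) ξ =
        ∫ γ, (max (f γ) 0) • Complex.exp (inner ℝ γ ξ * Complex.I) := by
    intro f hf ξ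
    rw [charFun_apply, integral_withDensity_eq_integral_toReal_smul₀
      hf.1.aemeasurable.ennreal_ofReal (ae_of_all _ fun γ => ENNReal.ofReal_lt_top)]
    simp only [ENNReal.toReal_ofReal']
  have := aux g hg
  have := aux (-g) hg.neg
  have hext : (volume.withDensity fun γ => ENNReal.ofReal (g γ)) =
      volume.withDensity fun γ => ENNReal.ofReal ((-g) γ) := by
    refine Measure.ext_of_charFun (funext fun ξ => ?_)
    rw [hchar g hg, hchar (-g) hg.neg, ← sub_eq_zero, ← integral_sub
      (integrable_smul_exp_inner hg.pos_part ξ) (integrable_smul_exp_inner hg.neg.pos_part ξ), ← h ξ]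
    refine integral_congr_ae (ae_of_all _ fun γ => ?_)
    simp only [← sub_smul, Pi.neg_apply]
    congr 1
    rcases le_total (g γ) 0 with h | h <;> simp [h]
  rw [withDensity_eq_iff hg.1.aemeasurable.ennreal_ofReal hg.neg.1.aemeasurable.ennreal_ofReal] at hext
  · filter_upwards [hext] with γ hγ
    have := congrArg ENNReal.toReal hγ
    simp only [ENNReal.toReal_ofReal', Pi.neg_apply] at this
    rcases le_total (g γ) 0 with h | h <;> simp_all
  · exact hg.lintegral_lt_top.ne

/-- A function in `L¹` is determined by its Radon transform on almost all hyperplanes. -/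
lemma ae_eq_of_radon_ae_eq {n : ℕ} {f₁ f₂ : Euc (n + 1) → ℝ} (h₁ : Integrable f₁)
    (h₂ : Integrable f₂)
    (h : ∀ᵐ s ∂((sphereMeasure (n + 1)).restrict (upperHemisphere n)), ∀ᵐ u : ℝ,
      radon f₁ s u = radon f₂ s u) : f₁ =ᵐ[volume] f₂ := by
  have hg : Integrable (f₁ - f₂) := h₁.sub h₂
  suffices hz : f₁ - f₂ =ᵐ[volume] 0 by
    filter_upwards [hz] with γ hγ using sub_eq_zero.1 hγ
  refine ae_eq_zero_of_integral_smul_exp_inner_eq_zero hg ?_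
  set F : Euc (n + 1) → ℂ := fun ξ =>
    ∫ γ, (f₁ - f₂) γ • Complex.exp (inner ℝ γ ξ * Complex.I) with hF
  have hcont : Continuous F := by
    refine continuous_of_dominated (bound := fun γ => ‖(f₁ - f₂) γ‖)
      (fun ξ => (integrable_smul_exp_inner hg ξ).1) (fun ξ => ae_of_all _ fun γ => ?_) hg.norm
      (ae_of_all _ fun γ => by fun_prop)
    rw [norm_smul, Complex.norm_exp_ofReal_mul_I, mul_one]
  -- Fourier slice theorem: along the line `ℝs`, the Fourier transform of `f` is the one-dimensional
  -- transform of `R[f](s, ·)`.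
  have hslice : ∀ s : Euc (n + 1), ‖s‖ = 1 → ∀ f : Euc (n + 1) → ℝ, Integrable f → ∀ t : ℝ,
      ∫ γ, f γ • Complex.exp (inner ℝ γ (t • s) * Complex.I) =
        ∫ u, radon f s u • Complex.exp ((t * u : ℝ) * Complex.I) := by
    intro s hs f hf t
    rw [← integral_smul_comp_inner hs (fun u : ℝ => Complex.exp ((t * u : ℝ) * Complex.I))]
    · simp only [inner_smul_right, real_inner_comm]
    · simpa only [inner_smul_right, real_inner_comm] using integrable_smul_exp_inner hf (t • s)
  have hgood : ∀ᵐ s ∂((sphereMeasure (n + 1)).restrict (upperHemisphere n)), ∀ t : ℝ,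
      F (t • s) = 0 := by
    filter_upwards [h, ae_restrict_mem (measurableSet_upperHemisphere n)] with s hs hsH t
    simp only [hF, Pi.sub_apply, sub_smul]
    rw [integral_sub (integrable_smul_exp_inner h₁ _) (integrable_smul_exp_inner h₂ _),
      hslice s hsH.1 f₁ h₁, hslice s hsH.1 f₂ h₂, sub_eq_zero]
    refine integral_congr_ae ?_
    filter_upwards [hs] with u hu
    rw [hu]
  -- The good directions are dense in the hemisphere and `F` is continuous, so no direction is
  -- exceptional.
  have hline : ∀ s ∈ upperHemisphere n, ∀ t : ℝ, F (t • s) = 0 := by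
    intro s hs t
    have hcl : IsClosed {s : Euc (n + 1) | F (t • s) = 0} :=
      isClosed_eq (hcont.comp (by fun_prop)) continuous_const
    exact hcl.mem_of_frequently_of_tendsto
      ((frequently_upperHemisphere hgood hs).mono fun s' hs' => hs'.2 t) tendsto_id
  have hhalf : ∀ ξ : Euc (n + 1), 0 < ξ (Fin.last n) → F ξ = 0 ∧ F (-ξ) = 0 := by
    intro ξ hξ
    have hne : ‖ξ‖ ≠ 0 := by
      rw [norm_ne_zero_iff]; rintro rfl; simp at hξ
    have hmem : ‖ξ‖⁻¹ • ξ ∈ upperHemisphere n := by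
      refine ⟨by rw [norm_smul, norm_inv, norm_norm, inv_mul_cancel₀ hne], ?_⟩
      simp only [PiLp.smul_apply, smul_eq_mul]
      positivity
    have h1 := hline _ hmem ‖ξ‖
    have h2 := hline _ hmem (-‖ξ‖)
    rw [smul_smul, mul_inv_cancel₀ hne, one_smul] at h1
    rw [smul_smul, neg_mul, mul_inv_cancel₀ hne, neg_smul, one_smul] at h2
    exact ⟨h1, h2⟩
  intro ξ
  have hcl : IsClosed {ξ : Euc (n + 1) | F ξ = 0} := isClosed_eq hcont continuous_const
  rcases lt_trichotomy (ξ (Fin.last n)) 0 with hξ | hξ | hξ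
  · have := (hhalf (-ξ) (by simpa using hξ)).2
    rwa [neg_neg] at this
  -- The lines through the hemisphere miss the equatorial hyperplane; its points are limits of
  -- points above it.
  · let e : Euc (n + 1) := PiLp.single 2 (Fin.last n) 1
    have ht : Tendsto (fun k : ℕ => ξ + (1 / ((k : ℝ) + 1)) • e) atTop (𝓝 ξ) := by
      have := (tendsto_one_div_add_atTop_nhds_zero_nat (𝕜 := ℝ)).smul_const e
      simpa using this.const_add ξ
    refine hcl.mem_of_tendsto ht (Eventually.of_forall fun k => (hhalf _ ?_).1)
    simp only [PiLp.add_apply, hξ, PiLp.smul_apply, e, PiLp.single_apply, if_true]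
    simp only [zero_add, smul_eq_mul, mul_one]
    positivity
  · exact (hhalf ξ hξ).1

lemma radonInv_ae_eq {n : ℕ} {G : Euc (n + 1) → ℝ → ℝ} {f : Euc (n + 1) → ℝ}
    (hf : IsRadonPreimage G f) : radonInv G =ᵐ[volume] f := by
  have H : InRadonRange G := ⟨f, hf⟩
  have hc := H.choose_spec
  rw [radonInv, dif_pos H]
  refine ae_eq_of_radon_ae_eq hc.1 hf.1 ?_
  filter_upwards [hc.2, hf.2] with s h1 h2
  filter_upwards [h1, h2] with u h3 h4
  rw [h3, h4]

end RadonTransform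

/-! ### Uniqueness of the continuous version on the support -/

section ContinuousVersions

variable {α : Type*} [TopologicalSpace α] [HereditarilyLindelofSpace α] [MeasurableSpace α]
  {ν : Measure α}

/-- If the functions differed at a point of the support, they would differ on a relative
neighbourhood of it, which has positive measure because the support is conull. Hence the choice made
in `contVersion` is harmless on the support. -/
lemma eqOn_support_of_ae_eq {h₁ h₂ : α → ℝ} (hc₁ : ContinuousOn h₁ ν.support)
    (hc₂ : ContinuousOn h₂ ν.support) (h : h₁ =ᵐ[ν] h₂) : Set.EqOn h₁ h₂ ν.support := by
  intro x hx
  by_contra hne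
  have hd : ∀ᶠ y in 𝓝[ν.support] x, h₁ y ≠ h₂ y :=
    ((hc₁ x hx).tendsto.prodMk_nhds (hc₂ x hx).tendsto).eventually
      (isClosed_diagonal.isOpen_compl.mem_nhds (by simpa using hne))
  rw [eventually_nhdsWithin_iff] at hd
  refine ((Measure.mem_support_iff_forall x).1 hx _ hd).ne' ?_
  have hs : ∀ᵐ y ∂ν, y ∈ ν.support := Measure.support_mem_ae
  refine measure_mono_null (fun y hy => ?_) (hs.and h)
  exact fun hy' => hy hy'.1 hy'.2

lemma TreatmentEffect.IsContVersion.eqOn_contVersion {g h : α → ℝ} (H : IsContVersion ν g h) :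
    Set.EqOn (contVersion ν g) h ν.support := by
  have H' : ∃ h, IsContVersion ν g h := ⟨h, H⟩
  rw [contVersion, dif_pos H']
  exact eqOn_support_of_ae_eq H'.choose_spec.1 H.1 (H'.choose_spec.2.symm.trans H.2)

end ContinuousVersions

/-! ### Derivatives of primitives within a closed support -/

section Derivatives

/-- A derivative within `F` is determined at accumulation points of `F`, and the points of `F`
isolated on the right are countably many, hence negligible. -/
lemma ae_hasDerivWithinAt_of_eqOn {F : Set ℝ} {h H d : ℝ → ℝ} (heq : Set.EqOn h H F)
    (hH : ∀ᵐ v, HasDerivAt H (d v) v) :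
    ∀ᵐ v, v ∈ F → HasDerivWithinAt h (d v) F v ∧ derivWithin h F v = d v := by
  have hnull := (countable_setOfPred_isolated_right_within (s := F)).measure_zero volume
  filter_upwards [hH, measure_eq_zero_iff_ae_notMem.1 hnull] with v hv hiso hvF
  have h1 : HasDerivWithinAt h (d v) F v := hv.hasDerivWithinAt.congr heq (heq hvF)
  refine ⟨h1, h1.derivWithin ?_⟩
  rw [uniqueDiffWithinAt_iff_accPt, accPt_principal_iff_nhdsWithin]
  have hne : (𝓝[F ∩ Set.Ioi v] v).NeBot := ⟨fun hbot => hiso ⟨hvF, hbot⟩⟩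
  refine hne.mono (nhdsWithin_mono _ ?_)
  exact fun y hy => ⟨hy.1, (Set.mem_Ioi.1 hy.2).ne'⟩

lemma setIntegral_Iio_eq {k : ℝ → ℝ} (hk : Integrable k) (v : ℝ) :
    ∫ u in Set.Iio v, k u = (∫ u in Set.Iic 0, k u) + ∫ u in (0 : ℝ)..v, k u := by
  rw [← intervalIntegral.integral_Iic_sub_Iic hk.integrableOn hk.integrableOn,
    integral_Iic_eq_integral_Iio (x := v)]
  ring

lemma ae_hasDerivAt_setIntegral_Iio {k : ℝ → ℝ} (hk : Integrable k) :
    ∀ᵐ v, HasDerivAt (fun v => ∫ u in Set.Iio v, k u) (k v) v := by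
  filter_upwards [LocallyIntegrable.ae_hasDerivAt_integral hk.locallyIntegrable] with v hv
  simp_rw [setIntegral_Iio_eq hk]
  exact (hv 0).const_add _

lemma continuous_setIntegral_Iio {k : ℝ → ℝ} (hk : Integrable k) :
    Continuous fun v => ∫ u in Set.Iio v, k u := by
  simp_rw [setIntegral_Iio_eq hk]
  exact continuous_const.add
    (intervalIntegral.continuous_primitive (fun a b => hk.intervalIntegrable) 0)

end Derivatives

/-! ### Differentiating the regression function for `L = 1` -/

section ScalarRegressor

variable {ν : Measure ℝ} {m : ℝ → ℝ} {c : ℝ} {k : ℝ → ℝ}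

lemma isContVersion_scalar (hk : Integrable k)
    (hm : ∀ᵐ v ∂ν, m v = c + ∫ u in Set.Iio v, k u) :
    IsContVersion ν m fun v => c + ∫ u in Set.Iio v, k u :=
  ⟨(continuous_const.add (continuous_setIntegral_Iio hk)).continuousOn, hm⟩

lemma hasDerivExt_of_ae_eq (hk : Integrable k)
    (hm : ∀ᵐ v ∂ν, m v = c + ∫ u in Set.Iio v, k u) : HasDerivExt ν m := by
  have H := isContVersion_scalar hk hm
  refine ⟨⟨_, H⟩, ?_⟩
  filter_upwards [ae_hasDerivWithinAt_of_eqOn H.eqOn_contVersion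
    ((ae_hasDerivAt_setIntegral_Iio hk).mono fun v hv => hv.const_add c)] with v hv hvF
  exact (hv hvF).1.differentiableWithinAt

lemma derivExt_ae_eq (hk : Integrable k)
    (hm : ∀ᵐ v ∂ν, m v = c + ∫ u in Set.Iio v, k u) :
    ∀ᵐ v, v ∈ ν.support → derivExt ν m v = k v := by
  have H := isContVersion_scalar hk hm
  filter_upwards [ae_hasDerivWithinAt_of_eqOn H.eqOn_contVersion
    ((ae_hasDerivAt_setIntegral_Iio hk).mono fun v hv => hv.const_add c)] with v hv hvF
  rw [derivExt, if_pos hvF]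
  exact (hv hvF).2

end ScalarRegressor

/-! ### Differentiating the regression function for `L ≥ 2`, and the role of large support -/

section VectorRegressor

variable {L n : ℕ}

lemma ae_inner_ne {s : Euc L} (hs : ‖s‖ = 1) (v : ℝ) : ∀ᵐ γ : Euc L, inner ℝ s γ ≠ v := by
  have hmp := measurePreserving_smul_add_orthogonal hs
  have hmeas : MeasurableSet {γ : Euc L | inner ℝ s γ = v} :=
    (isClosed_eq (by fun_prop) continuous_const).measurableSet
  have : volume {γ : Euc L | inner ℝ s γ = v} = 0 := by
    rw [← hmp.measure_preimage hmeas.nullMeasurableSet]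
    have : (fun p : ℝ × (Submodule.span ℝ {s})ᗮ => p.1 • s + (p.2 : Euc L)) ⁻¹'
        {γ : Euc L | inner ℝ s γ = v} = {v} ×ˢ Set.univ := by
      ext p
      simp [inner_smul_add_orthogonal hs]
    rw [this, Measure.prod_prod]
    simp
  exact measure_eq_zero_iff_ae_notMem.1 this

lemma setIntegral_inner_lt {s : Euc L} (hs : ‖s‖ = 1) {g : Euc L → ℝ} (hg : Integrable g)
    (v : ℝ) : ∫ γ in {γ | inner ℝ s γ < v}, g γ = ∫ u in Set.Iio v, radon g s u := by
  have hmeas : MeasurableSet {γ : Euc L | inner ℝ s γ < v} :=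
    (isOpen_lt (by fun_prop) continuous_const).measurableSet
  have hfun : (fun γ => g γ • (Set.Iio v).indicator (1 : ℝ → ℝ) (inner ℝ s γ)) =
      {γ : Euc L | inner ℝ s γ < v}.indicator g := by
    ext γ
    by_cases h : inner ℝ s γ < v <;> simp [Set.indicator, h]
  rw [← integral_indicator hmeas, ← hfun, integral_smul_comp_inner hs,
    ← integral_indicator measurableSet_Iio]
  · refine integral_congr_ae (ae_of_all _ fun u => ?_)
    by_cases h : u < v <;> simp [Set.indicator, h]
  · rw [hfun]
    exact hg.indicator hmeas

/-- Dominated convergence: the indicator of the half-space is continuous in `(s, v)` except when `γ`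
lies on the bounding hyperplane, which is null because `s` is a unit vector. -/
lemma continuousOn_setIntegral_inner_lt {g : Euc L → ℝ} (hg : Integrable g) :
    ContinuousOn (fun p : Euc L × ℝ => ∫ γ in {γ | inner ℝ p.1 γ < p.2}, g γ)
      {p | ‖p.1‖ = 1} := by
  have hmeas : ∀ p : Euc L × ℝ, MeasurableSet {γ : Euc L | inner ℝ p.1 γ < p.2} := fun p =>
    (isOpen_lt (by fun_prop) continuous_const).measurableSet
  simp_rw [← integral_indicator (hmeas _)]
  intro p hp
  refine continuousWithinAt_of_dominated (bound := fun γ => ‖g γ‖)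
    (Eventually.of_forall fun q => (hg.indicator (hmeas q)).1)
    (Eventually.of_forall fun q => ae_of_all _ fun γ => norm_indicator_le_norm_self _ _)
    hg.norm ?_
  filter_upwards [ae_inner_ne hp p.2] with γ hγ
  have hc : Continuous fun q : Euc L × ℝ => inner ℝ q.1 γ := by fun_prop
  refine ContinuousAt.continuousWithinAt ?_
  rcases lt_or_gt_of_ne hγ with h | h
  · refine (continuousAt_const (y := g γ)).congr ?_
    filter_upwards [(isOpen_lt hc continuous_snd).mem_nhds h] with q hq
    exact (Set.indicator_of_mem (s := {γ | inner ℝ q.1 γ < q.2}) hq g).symm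
  · refine (continuousAt_const (y := 0)).congr ?_
    filter_upwards [(isOpen_lt continuous_snd hc).mem_nhds h] with q hq
    exact (Set.indicator_of_notMem (s := {γ | inner ℝ q.1 γ < q.2})
      (not_lt.2 (le_of_lt hq)) g).symm

variable {ν : Measure (Euc (n + 1) × ℝ)} {m : Euc (n + 1) × ℝ → ℝ} {c : ℝ}
  {g : Euc (n + 1) → ℝ}

lemma support_subset_sphere (hν : ∀ᵐ p ∂ν, ‖p.1‖ = 1) : ν.support ⊆ {p | ‖p.1‖ = 1} :=
  Measure.support_subset_of_isClosed (isClosed_eq (by fun_prop) continuous_const) hν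

lemma isContVersion_vector (hν : ∀ᵐ p ∂ν, ‖p.1‖ = 1) (hg : Integrable g)
    (hm : ∀ᵐ p ∂ν, m p = c + ∫ γ in {γ | inner ℝ p.1 γ < p.2}, g γ) :
    IsContVersion ν m fun p => c + ∫ γ in {γ | inner ℝ p.1 γ < p.2}, g γ :=
  ⟨(continuousOn_const.add (continuousOn_setIntegral_inner_lt hg)).mono
    (support_subset_sphere hν), hm⟩

lemma ae_hasDerivWithinAt_contVersion (hν : ∀ᵐ p ∂ν, ‖p.1‖ = 1) (hg : Integrable g)
    (hm : ∀ᵐ p ∂ν, m p = c + ∫ γ in {γ | inner ℝ p.1 γ < p.2}, g γ)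
    {s : Euc (n + 1)} (hs : ‖s‖ = 1) :
    ∀ᵐ v, v ∈ slice ν s →
      HasDerivWithinAt (fun w => contVersion ν m (s, w)) (radon g s v) (slice ν s) v ∧
      derivWithin (fun w => contVersion ν m (s, w)) (slice ν s) v = radon g s v := by
  have H := isContVersion_vector hν hg hm
  refine ae_hasDerivWithinAt_of_eqOn (H := fun v => c + ∫ u in Set.Iio v, radon g s u)
    (fun v hv => ?_)
    ((ae_hasDerivAt_setIntegral_Iio (integrable_radon hs hg)).mono fun v hv => hv.const_add c)
  rw [H.eqOn_contVersion hv]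
  simp only [setIntegral_inner_lt hs hg]

lemma hasPartialExt_of_ae_eq (hν : ∀ᵐ p ∂ν, ‖p.1‖ = 1) (hg : Integrable g)
    (hm : ∀ᵐ p ∂ν, m p = c + ∫ γ in {γ | inner ℝ p.1 γ < p.2}, g γ) : HasPartialExt ν m := by
  refine ⟨⟨_, isContVersion_vector hν hg hm⟩, ?_⟩
  filter_upwards [ae_restrict_mem (measurableSet_upperHemisphere n)] with s hs
  filter_upwards [ae_hasDerivWithinAt_contVersion hν hg hm hs.1] with v hv hvF
  exact (hv hvF).1.differentiableWithinAt

/-- On the slice of the support the derivative is `R[g]`. Off it, `hoff` makes `g` vanish on almost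
all the hyperplanes concerned, so `R[g]` is `0`, in agreement with the extension. -/
lemma isRadonPreimage_partialExt (hν : ∀ᵐ p ∂ν, ‖p.1‖ = 1) (hg : Integrable g)
    (hm : ∀ᵐ p ∂ν, m p = c + ∫ γ in {γ | inner ℝ p.1 γ < p.2}, g γ)
    (hoff : ∀ s ∈ upperHemisphere n, ∀ᵐ γ, inner ℝ s γ ∈ (slice ν s)ᶜ → g γ = 0) :
    IsRadonPreimage (partialExt ν m) g := by
  refine ⟨hg, ?_⟩
  filter_upwards [ae_restrict_mem (measurableSet_upperHemisphere n)] with s hs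
  filter_upwards [ae_hasDerivWithinAt_contVersion hν hg hm hs.1,
    radon_ae_eq_zero hs.1 (hoff s hs)] with v hv hz
  rw [partialExt]
  split_ifs with h
  · exact (hv h).2.symm
  · exact hz h

/-- Large support is only known for almost every `s` under the law of `S̃`, whose null sets need not
be null for the spherical measure. Strict inequalities are open in `s` and the support of `ν` is
closed, so the inclusion passes from directions arbitrarily near `s₀` to `s₀` itself. -/
lemma ae_inner_mem_slice {μ : Measure (Euc (n + 1))} {s₀ : Euc (n + 1)} (hs₀ : ‖s₀‖ = 1)
    (hfreq : ∃ᶠ s in 𝓝 s₀, ∀ γ₁ ∈ μ.support, ∀ γ₂ ∈ μ.support, ∀ v : ℝ,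
      inner ℝ s γ₁ < v → v < inner ℝ s γ₂ → v ∈ slice ν s) :
    ∀ᵐ γ, γ ∈ μ.support → inner ℝ s₀ γ ∈ slice ν s₀ := by
  have hin : ∀ γ₁ ∈ μ.support, ∀ γ₂ ∈ μ.support, ∀ v : ℝ,
      inner ℝ s₀ γ₁ < v → v < inner ℝ s₀ γ₂ → v ∈ slice ν s₀ := by
    intro γ₁ h₁ γ₂ h₂ v hv₁ hv₂
    have hc : ∀ γ : Euc (n + 1), Continuous fun s : Euc (n + 1) => inner ℝ s γ := fun γ => by
      fun_prop
    have hev : ∀ᶠ s in 𝓝 s₀, inner ℝ s γ₁ < v ∧ v < inner ℝ s γ₂ :=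
      ((hc γ₁).continuousAt.eventually_lt continuousAt_const hv₁).and
        (continuousAt_const.eventually_lt (hc γ₂).continuousAt hv₂)
    have hcl : IsClosed {s : Euc (n + 1) | (s, v) ∈ ν.support} :=
      Measure.isClosed_support.preimage (by fun_prop)
    exact hcl.mem_of_frequently_of_tendsto
      ((hfreq.and_eventually hev).mono fun s hs => hs.1 γ₁ h₁ γ₂ h₂ v hs.2.1 hs.2.2) tendsto_id
  -- The limit argument only reaches values strictly between two others. A minimum or maximum of
  -- `⟪s₀, γ⟫` over the support is attained on a single hyperplane, which is null.
  have hend : ∀ E : Set ℝ, E.Subsingleton → ∀ᵐ γ : Euc (n + 1), inner ℝ s₀ γ ∉ E := by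
    intro E hE
    rcases hE.eq_empty_or_singleton with rfl | ⟨v, rfl⟩
    · simp
    · simpa using ae_inner_ne hs₀ v
  let I : Set ℝ := (fun γ => inner ℝ s₀ γ) '' μ.support
  filter_upwards [hend {v | IsLeast I v} fun a ha b hb => ha.unique hb,
    hend {v | IsGreatest I v} fun a ha b hb => ha.unique hb] with γ hl hg hγ
  have hmem : inner ℝ s₀ γ ∈ I := ⟨γ, hγ, rfl⟩
  have h1 : ∃ γ₁ ∈ μ.support, inner ℝ s₀ γ₁ < inner ℝ s₀ γ := by
    by_contra! hcon
    exact hl ⟨hmem, by rintro _ ⟨γ', h', rfl⟩; exact hcon γ' h'⟩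
  have h2 : ∃ γ₂ ∈ μ.support, inner ℝ s₀ γ < inner ℝ s₀ γ₂ := by
    by_contra! hcon
    exact hg ⟨hmem, by rintro _ ⟨γ', h', rfl⟩; exact hcon γ' h'⟩
  obtain ⟨γ₁, hm₁, h1⟩ := h1
  obtain ⟨γ₂, hm₂, h2⟩ := h2
  exact hin γ₁ hm₁ γ₂ hm₂ _ h1 h2

end VectorRegressor

/-! ### Conditional means and independence -/

section ConditionalMeans

variable {Ω 𝒰 𝒞 : Type*} [MeasurableSpace Ω] [MeasurableSpace 𝒰] [MeasurableSpace 𝒞]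
  {Q : Measure Ω} [IsProbabilityMeasure Q] {U : Ω → 𝒰} {C : Ω → 𝒞} {W W₁ W₂ : Ω → ℝ}

lemma measurable_condMean (W : Ω → ℝ) (U : Ω → 𝒰) : Measurable (condMean Q W U) :=
  (measurable_snd.stronglyMeasurable.integral_condDistrib (f := Prod.snd)).measurable

lemma condExp_ae_eq_condMean (hU : Measurable U) (hW : Integrable W Q) :
    Q[W | MeasurableSpace.comap U inferInstance] =ᵐ[Q] fun ω => condMean Q W U (U ω) :=
  condExp_ae_eq_integral_condDistrib' hU hW

lemma condMean_ae_eq_of_condExp (hU : Measurable U) (hW : Integrable W Q) {F : 𝒰 → ℝ}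
    (hF : Measurable F)
    (h : Q[W | MeasurableSpace.comap U inferInstance] =ᵐ[Q] fun ω => F (U ω)) :
    condMean Q W U =ᵐ[Q.map U] F := by
  refine (ae_map_iff hU.aemeasurable (measurableSet_eq_fun (measurable_condMean W U) hF)).2 ?_
  exact (condExp_ae_eq_condMean hU hW).symm.trans h

lemma condMean_linear (hU : Measurable U) (h₁ : Integrable W₁ Q) (h₂ : Integrable W₂ Q)
    (a b : ℝ) : condMean Q (fun ω => a * W₁ ω + b * W₂ ω) U =ᵐ[Q.map U]
      fun u => a * condMean Q W₁ U u + b * condMean Q W₂ U u := by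
  refine condMean_ae_eq_of_condExp hU ((h₁.const_mul a).add (h₂.const_mul b))
    (((measurable_condMean W₁ U).const_mul a).add ((measurable_condMean W₂ U).const_mul b)) ?_
  have e1 := condExp_add (h₁.const_mul a) (h₂.const_mul b) (MeasurableSpace.comap U inferInstance)
  have e2 := condExp_smul (μ := Q) a W₁ (MeasurableSpace.comap U inferInstance)
  have e3 := condExp_smul (μ := Q) b W₂ (MeasurableSpace.comap U inferInstance)
  filter_upwards [e1, e2, e3, condExp_ae_eq_condMean hU h₁, condExp_ae_eq_condMean hU h₂]
    with ω h1 h2 h3 h4 h5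
  rw [← h4, ← h5]
  simp only [Pi.add_apply, Pi.smul_apply, smul_eq_mul] at h1 h2 h3
  rw [← h2, ← h3]
  exact h1

lemma integrable_condMean (hU : Measurable U) (hW : Integrable W Q) :
    Integrable (condMean Q W U) (Q.map U) := by
  rw [integrable_map_measure (measurable_condMean W U).aestronglyMeasurable hU.aemeasurable]
  exact (integrable_congr (condExp_ae_eq_condMean hU hW)).1 integrable_condExp

lemma setIntegral_condMean (hU : Measurable U) (hW : Integrable W Q) {B : Set 𝒰}
    (hB : MeasurableSet B) :
    ∫ u in B, condMean Q W U u ∂(Q.map U) = ∫ ω in U ⁻¹' B, W ω ∂Q := by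
  rw [setIntegral_map hB (measurable_condMean W U).aestronglyMeasurable hU.aemeasurable,
    ← setIntegral_condExp hU.comap_le hW ⟨B, hB, rfl⟩]
  exact integral_congr_ae (ae_restrict_of_ae (condExp_ae_eq_condMean hU hW).symm)

lemma integral_condMean (hU : Measurable U) (hW : Integrable W Q) :
    ∫ u, condMean Q W U u ∂(Q.map U) = ∫ ω, W ω ∂Q := by
  simpa using setIntegral_condMean hU hW MeasurableSet.univ

/-- Independence makes the conditional law of `(W, U)` given `C` constant. Freezing `C = c`
therefore leaves the integral of `W` over `{(c, U) ∈ A}`, which is then conditioned on `U`. -/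
lemma condMean_indicator_of_indepFun [StandardBorelSpace 𝒰] [Nonempty 𝒰]
    (hU : Measurable U) (hC : Measurable C) (hW : Measurable W)
    (hWi : Integrable W Q) (hind : IndepFun C (fun ω => (W ω, U ω)) Q) {A : Set (𝒞 × 𝒰)}
    (hA : MeasurableSet A) :
    condMean Q (fun ω => A.indicator (fun _ => W ω) (C ω, U ω)) C =ᵐ[Q.map C]
      fun c => ∫ u in {u | (c, u) ∈ A}, condMean Q W U u ∂(Q.map U) := by
  have hint : Integrable (fun ω => A.indicator (fun _ => W ω) (C ω, U ω)) Q :=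
    hWi.indicator (hA.preimage (hC.prodMk hU))
  have hWU : Measurable fun ω => (W ω, U ω) := hW.prodMk hU
  let f : 𝒞 × (ℝ × 𝒰) → ℝ := fun p => A.indicator (fun _ => p.2.1) (p.1, p.2.2)
  have hf : Measurable f :=
    Measurable.indicator (f := fun p : 𝒞 × (ℝ × 𝒰) => p.2.1) (by fun_prop)
      (hA.preimage (by fun_prop : Measurable fun p : 𝒞 × (ℝ × 𝒰) => (p.1, p.2.2)))
  have hkey : ∀ c, ∫ p, f (c, p) ∂(Q.map fun ω => (W ω, U ω)) =
      ∫ u in {u | (c, u) ∈ A}, condMean Q W U u ∂(Q.map U) := by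
    intro c
    have hAc : MeasurableSet {u | (c, u) ∈ A} := hA.preimage (by fun_prop)
    rw [setIntegral_condMean hU hWi hAc, ← integral_indicator (hU hAc)]
    exact integral_map hWU.aemeasurable (hf.comp measurable_prodMk_left).aestronglyMeasurable
  have hconst : condDistrib (fun ω => (W ω, U ω)) C Q =ᵐ[Q.map C]
      Kernel.const 𝒞 (Q.map fun ω => (W ω, U ω)) := by
    refine condDistrib_ae_eq_of_measure_eq_compProd C hWU.aemeasurable ?_
    rw [Measure.compProd_const]
    exact (indepFun_iff_map_prod_eq_prod_map_map hC.aemeasurable hWU.aemeasurable).1 hind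
  refine condMean_ae_eq_of_condExp hC hint ?_ ?_
  · simp_rw [← hkey]
    exact (hf.stronglyMeasurable.integral_prod_right').measurable
  · refine (condExp_prod_ae_eq_integral_condDistrib hC hWU.aemeasurable
      hf.stronglyMeasurable hint).trans ?_
    filter_upwards [ae_of_ae_map hC.aemeasurable hconst] with ω hω
    rw [hω, Kernel.const_apply, hkey]

end ConditionalMeans

/-! ### From the law of the unobservable to Lebesgue measure -/

section Densities

variable {𝒰 : Type*} [MeasureSpace 𝒰] [SigmaFinite (volume : Measure 𝒰)] {μ : Measure 𝒰}
  [IsFiniteMeasure μ]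

lemma ae_of_density_ne_zero (hμ : μ ≪ volume) {p : 𝒰 → Prop} (hp : ∀ᵐ u ∂μ, p u) :
    ∀ᵐ u, (μ.rnDeriv volume u).toReal ≠ 0 → p u := by
  rw [← Measure.withDensity_rnDeriv_eq μ volume hμ,
    ae_withDensity_iff (Measure.measurable_rnDeriv μ volume)] at hp
  filter_upwards [hp] with u hu h
  exact hu fun h0 => h (by simp [h0])

lemma density_ae_eq_zero (hμ : μ ≪ volume) {p : 𝒰 → Prop} (hp : ∀ᵐ u ∂μ, p u) :
    ∀ᵐ u, ¬ p u → (μ.rnDeriv volume u).toReal = 0 := by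
  filter_upwards [ae_of_density_ne_zero hμ hp] with u hu h
  by_contra h0
  exact h (hu h0)

lemma integrable_mul_density_iff (hμ : μ ≪ volume) {m : 𝒰 → ℝ} :
    Integrable (fun u => m u * (μ.rnDeriv volume u).toReal) ↔ Integrable m μ := by
  rw [← integrable_rnDeriv_smul_iff hμ]
  simp only [smul_eq_mul, mul_comm]

lemma setIntegral_mul_density (hμ : μ ≪ volume) (m : 𝒰 → ℝ) {B : Set 𝒰} (hB : MeasurableSet B) :
    ∫ u in B, m u * (μ.rnDeriv volume u).toReal = ∫ u in B, m u ∂μ := by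
  rw [← setIntegral_rnDeriv_smul hμ hB]
  simp only [smul_eq_mul, mul_comm]

lemma integral_mul_density (hμ : μ ≪ volume) (m : 𝒰 → ℝ) :
    ∫ u, m u * (μ.rnDeriv volume u).toReal = ∫ u, m u ∂μ := by
  simpa using setIntegral_mul_density hμ m MeasurableSet.univ

end Densities

/-! ### The regression function as an integral of the effect density -/

section Regression

variable {Ω 𝒰 𝒞 : Type*} [MeasurableSpace Ω] [MeasureSpace 𝒰] [StandardBorelSpace 𝒰] [Nonempty 𝒰]
  [SigmaFinite (volume : Measure 𝒰)] [MeasurableSpace 𝒞]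
  {Q : Measure Ω} [IsProbabilityMeasure Q] {U : Ω → 𝒰} {C : Ω → 𝒞} {W W₀ W₁ : Ω → ℝ}

/-- The difference of the conditional means of `W₁` and `W₀` given `U`, times the density
of `U`. -/
noncomputable def effectDensity (Q : Measure Ω) [IsProbabilityMeasure Q] (W₀ W₁ : Ω → ℝ)
    (U : Ω → 𝒰) (u : 𝒰) : ℝ :=
  (condMean Q W₁ U u - condMean Q W₀ U u) * ((Q.map U).rnDeriv volume u).toReal

omit [StandardBorelSpace 𝒰] [Nonempty 𝒰] in
lemma integrable_effectDensity (hU : Measurable U) (hμ : Q.map U ≪ volume)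
    (h₀ : Integrable W₀ Q) (h₁ : Integrable W₁ Q) : Integrable (effectDensity Q W₀ W₁ U) :=
  (integrable_mul_density_iff hμ).2 ((integrable_condMean hU h₁).sub (integrable_condMean hU h₀))

/-- `W` is `W₁` on `A` plus `W₀` on the complement. Each term involves one potential outcome only,
so separate independence suffices; replacing the integral over `Aᶜ` by the total minus the integral
over `A` produces the constant. -/
lemma condMean_of_indepFun (hU : Measurable U) (hμ : Q.map U ≪ volume) (hC : Measurable C)
    (hW₀ : Measurable W₀) (hW₁ : Measurable W₁) (hi₀ : Integrable W₀ Q) (hi₁ : Integrable W₁ Q)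
    (hind₀ : IndepFun C (fun ω => (W₀ ω, U ω)) Q) (hind₁ : IndepFun C (fun ω => (W₁ ω, U ω)) Q)
    {A : Set (𝒞 × 𝒰)} (hA : MeasurableSet A)
    (hin : ∀ ω, (C ω, U ω) ∈ A → W ω = W₁ ω) (hout : ∀ ω, (C ω, U ω) ∉ A → W ω = W₀ ω) :
    ∀ᵐ c ∂(Q.map C), condMean Q W C c =
      (∫ ω, W₀ ω ∂Q) + ∫ u in {u | (c, u) ∈ A}, effectDensity Q W₀ W₁ U u := by
  have hm : MeasurableSet ((fun ω => (C ω, U ω)) ⁻¹' A) := hA.preimage (hC.prodMk hU)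
  have e1 : (fun ω => (1 : ℝ) * A.indicator (fun _ => W₁ ω) (C ω, U ω) +
      1 * Aᶜ.indicator (fun _ => W₀ ω) (C ω, U ω)) = W := by
    ext ω
    by_cases h : (C ω, U ω) ∈ A
    · simp [h, hin ω h]
    · simp [h, hout ω h]
  have h := condMean_linear (W₁ := fun ω => A.indicator (fun _ => W₁ ω) (C ω, U ω))
    (W₂ := fun ω => Aᶜ.indicator (fun _ => W₀ ω) (C ω, U ω)) hC (hi₁.indicator hm)
    (hi₀.indicator hm.compl) 1 1
  rw [e1] at h
  filter_upwards [h, condMean_indicator_of_indepFun hU hC hW₁ hi₁ hind₁ hA,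
    condMean_indicator_of_indepFun hU hC hW₀ hi₀ hind₀ hA.compl] with c h1 h2 h3
  have hAc : MeasurableSet {u | (c, u) ∈ A} := hA.preimage (by fun_prop)
  have hsplit := integral_add_compl hAc (integrable_condMean hU hi₀)
  rw [integral_condMean hU hi₀] at hsplit
  have hcompl : {u | (c, u) ∈ Aᶜ} = {u | (c, u) ∈ A}ᶜ := rfl
  rw [h1, h2, h3, hcompl, one_mul, one_mul]
  unfold effectDensity
  rw [setIntegral_mul_density hμ (fun u => condMean Q W₁ U u - condMean Q W₀ U u) hAc, integral_sub
    (integrable_condMean hU hi₁).integrableOn (integrable_condMean hU hi₀).integrableOn]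
  linarith

end Regression

/-! ### Conditional variances and the law of total variance -/

section ConditionalVariances

variable {Ω 𝒰 : Type*} [MeasurableSpace Ω] [MeasurableSpace 𝒰]
  {Q : Measure Ω} [IsProbabilityMeasure Q] {U : Ω → 𝒰} {W : Ω → ℝ}

lemma condMean_sq_ae_eq (W : Ω → ℝ) (hW : Measurable W) :
    ∀ᵐ u ∂(Q.map U), condMean Q (fun ω => W ω ^ 2) U u = ∫ w, w ^ 2 ∂(condDistrib W U Q u) := by
  filter_upwards [condDistrib_comp (μ := Q) U hW.aemeasurable
    (f := fun w : ℝ => w ^ 2) (by fun_prop)] with u hu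
  change ∫ w, w ∂(condDistrib ((fun w : ℝ => w ^ 2) ∘ W) U Q u) = _
  rw [hu, Kernel.map_apply _ (by fun_prop)]
  exact integral_map (by fun_prop) (by fun_prop)

lemma condVariance_ae_eq (hU : Measurable U) (hW : Measurable W) (hW2 : MemLp W 2 Q) :
    ∀ᵐ u ∂(Q.map U), condVariance Q W U u =
      condMean Q (fun ω => W ω ^ 2) U u - condMean Q W U u ^ 2 := by
  have hint : Integrable (fun p : 𝒰 × ℝ => p.2 ^ 2) (Q.map fun ω => (U ω, W ω)) := by
    rw [integrable_map_measure (by fun_prop) (hU.prodMk hW).aemeasurable]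
    exact hW2.integrable_sq
  filter_upwards [condMean_sq_ae_eq (U := U) W hW,
    hint.condDistrib_ae_map hW.aemeasurable] with u h1 h2
  have hL : MemLp (fun w : ℝ => w) 2 (condDistrib W U Q u) :=
    (memLp_two_iff_integrable_sq (by fun_prop)).2 h2
  rw [condVariance, variance_eq_sub hL, h1]
  rfl

lemma memLp_condMean (hU : Measurable U) (hW2 : MemLp W 2 Q) :
    MemLp (condMean Q W U) 2 (Q.map U) := by
  rw [memLp_map_measure_iff (measurable_condMean W U).aestronglyMeasurable hU.aemeasurable]
  have hi : Integrable W Q := hW2.integrable (by norm_num)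
  exact (memLp_congr_ae (condExp_ae_eq_condMean hU hi)).1 (hW2.condExp (by norm_num))

lemma integrable_condVariance (hU : Measurable U) (hW : Measurable W) (hW2 : MemLp W 2 Q) :
    Integrable (condVariance Q W U) (Q.map U) :=
  ((integrable_condMean hU hW2.integrable_sq).sub (memLp_condMean hU hW2).integrable_sq).congr
    ((condVariance_ae_eq hU hW hW2).mono fun _ h => h.symm)

lemma integrable_sq_condMean_sub (hU : Measurable U) (hW2 : MemLp W 2 Q) (a : ℝ) :
    Integrable (fun u => (condMean Q W U u - a) ^ 2) (Q.map U) :=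
  have := Measure.isProbabilityMeasure_map (μ := Q) hU.aemeasurable
  ((memLp_condMean hU hW2).sub (memLp_const a)).integrable_sq

/-- The law of total variance. -/
lemma variance_eq_integral_condVariance_add (hU : Measurable U) (hW : Measurable W)
    (hW2 : MemLp W 2 Q) : variance W Q = (∫ u, condVariance Q W U u ∂(Q.map U)) +
      ∫ u, (condMean Q W U u - ∫ ω, W ω ∂Q) ^ 2 ∂(Q.map U) := by
  have := Measure.isProbabilityMeasure_map (μ := Q) hU.aemeasurable
  have hi : Integrable W Q := hW2.integrable (by norm_num)
  have hm := integrable_condMean hU hi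
  have hm2 := (memLp_condMean hU hW2).integrable_sq
  set E := ∫ ω, W ω ∂Q with hE
  have h1 : ∫ u, condVariance Q W U u ∂(Q.map U) =
      (∫ ω, W ω ^ 2 ∂Q) - ∫ u, condMean Q W U u ^ 2 ∂(Q.map U) := by
    rw [integral_congr_ae (condVariance_ae_eq hU hW hW2), integral_sub
      (integrable_condMean hU hW2.integrable_sq) hm2, integral_condMean hU hW2.integrable_sq]
  have h2 : ∫ u, (condMean Q W U u - E) ^ 2 ∂(Q.map U) =
      (∫ u, condMean Q W U u ^ 2 ∂(Q.map U)) - E ^ 2 := by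
    have : ∀ u, (condMean Q W U u - E) ^ 2 =
        condMean Q W U u ^ 2 - (2 * E * condMean Q W U u - E ^ 2) := fun u => by ring
    simp_rw [this]
    have hm3 : Integrable (fun u => 2 * E * condMean Q W U u - E ^ 2) (Q.map U) :=
      (hm.const_mul _).sub (integrable_const _)
    rw [integral_sub hm2 hm3, integral_sub (hm.const_mul _)
      (integrable_const _), integral_const_mul, integral_condMean hU hi]
    simp
    ring
  rw [h1, h2, variance_eq_sub hW2]
  simp [hE]

end ConditionalVariances

/-! ### Conditional variance of the effect from the uncorrelatedness assumption -/

section VarianceFormula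

variable {Ω 𝒰 : Type*} [MeasurableSpace Ω] [MeasurableSpace 𝒰]
  {Q : Measure Ω} [IsProbabilityMeasure Q] {U : Ω → 𝒰} {Y₀ Y₁ : Ω → ℝ}

lemma condVariance_sub_ae_eq (hU : Measurable U) (hY₀ : Measurable Y₀) (hY₁ : Measurable Y₁)
    (h₀ : MemLp Y₀ 2 Q) (h₁ : MemLp Y₁ 2 Q)
    (huncorr : ∀ᵐ u ∂(Q.map U), condMean Q (fun ω => Y₀ ω * (Y₁ ω - Y₀ ω)) U u =
      condMean Q Y₀ U u * condMean Q (fun ω => Y₁ ω - Y₀ ω) U u) :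
    ∀ᵐ u ∂(Q.map U), condVariance Q (fun ω => Y₁ ω - Y₀ ω) U u =
      (condMean Q (fun ω => Y₁ ω ^ 2) U u - condMean Q (fun ω => Y₀ ω ^ 2) U u) +
      (condMean Q Y₁ U u - condMean Q Y₀ U u) *
        (condMean Q (fun ω => -Y₁ ω) U u - condMean Q Y₀ U u) := by
  have i₀ : Integrable Y₀ Q := h₀.integrable (by norm_num)
  have i₁ : Integrable Y₁ Q := h₁.integrable (by norm_num)
  have hΔ : MemLp (fun ω => Y₁ ω - Y₀ ω) 2 Q := h₁.sub h₀
  have hprod : Integrable (fun ω => Y₀ ω * (Y₁ ω - Y₀ ω)) Q := h₀.integrable_mul hΔ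
  have l1 := condMean_linear hU i₁ i₀ 1 (-1)
  have l2 := condMean_linear hU i₁ i₀ (-1) 0
  -- `l3` and `l4` together compute the conditional mean of `Δ² = Y₁² - Y₀² - 2 Y₀ Δ`, whose last
  -- term factorises by `huncorr`.
  have l3 := condMean_linear hU h₀.integrable_sq hprod (-1) (-2)
  have l4 := condMean_linear (W₂ := fun ω => -1 * Y₀ ω ^ 2 + -2 * (Y₀ ω * (Y₁ ω - Y₀ ω)))
    hU h₁.integrable_sq ((h₀.integrable_sq.const_mul (-1)).add (hprod.const_mul (-2))) 1 1
  have e1 : (fun ω => 1 * Y₁ ω + -1 * Y₀ ω) = fun ω => Y₁ ω - Y₀ ω := by ext; ring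
  have e2 : (fun ω => -1 * Y₁ ω + 0 * Y₀ ω) = fun ω => -Y₁ ω := by ext; ring
  have e3 : (fun ω => 1 * Y₁ ω ^ 2 + 1 * (-1 * Y₀ ω ^ 2 + -2 * (Y₀ ω * (Y₁ ω - Y₀ ω)))) =
      fun ω => (Y₁ ω - Y₀ ω) ^ 2 := by ext; ring
  rw [e1] at l1
  rw [e2] at l2
  rw [e3] at l4
  filter_upwards [l1, l2, l3, l4, huncorr,
    condVariance_ae_eq (W := fun ω => Y₁ ω - Y₀ ω) hU (hY₁.sub hY₀) hΔ]
    with u h1 h2 h3 h4 h5 h6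
  rw [h6, h4, h3, h5, h2, h1]
  ring

end VarianceFormula

/-! ### Conditioning in two stages -/

section Transfer

variable {Ω E 𝒳 𝒞 𝒲 : Type*} [MeasurableSpace Ω] [MeasurableSpace E] [StandardBorelSpace E]
  [Nonempty E] [MeasurableSpace 𝒳] [MeasurableSpace 𝒞] [StandardBorelSpace 𝒞] [Nonempty 𝒞]
  [MeasurableSpace 𝒲] [StandardBorelSpace 𝒲] [Nonempty 𝒲]
  {P : Measure Ω} [IsProbabilityMeasure P] {X : Ω → 𝒳} {T : Ω → E}

lemma condDistrib_comp_ae_eq_map (hT : Measurable T) {w : E → 𝒲} (hw : Measurable w) :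
    ∀ᵐ x ∂(P.map X), condDistrib (fun ω => w (T ω)) X P x = (condDistrib T X P x).map w := by
  filter_upwards [condDistrib_comp (μ := P) X hT.aemeasurable hw] with x hx
  rw [← Kernel.map_apply _ hw]
  exact hx

lemma ae_ae_condDistrib_of_ae_map {C : Ω → 𝒞} (hX : Measurable X) (hC : Measurable C)
    {p : 𝒞 × 𝒳 → Prop} (hp : ∀ᵐ q ∂(P.map fun ω => (C ω, X ω)), p q) :
    ∀ᵐ x ∂(P.map X), ∀ᵐ c ∂(condDistrib C X P x), p (c, x) := by
  have h : ∀ᵐ q ∂(P.map X ⊗ₘ condDistrib C X P), p q.swap := by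
    rw [compProd_map_condDistrib hC.aemeasurable]
    have hswap : P.map (fun ω => (C ω, X ω)) = (P.map fun ω => (X ω, C ω)).map Prod.swap := by
      rw [Measure.map_map measurable_swap (hX.prodMk hC)]
      rfl
    rw [hswap] at hp
    exact ae_of_ae_map measurable_swap.aemeasurable hp
  exact Measure.ae_ae_of_ae_compProd h

/-- By uniqueness of disintegrations it is enough that both sides rebuild the law of `(X, (C, W))`;
disintegrating first over `(C, X)` and then over `X` shows it. -/
lemma condDistrib_prodMk_ae_eq_compProd {C : Ω → 𝒞} {W : Ω → 𝒲} (hX : Measurable X)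
    (hC : Measurable C) (hW : Measurable W) :
    condDistrib (fun ω => (C ω, W ω)) X P =ᵐ[P.map X] condDistrib C X P ⊗ₖ
      (condDistrib W (fun ω => (C ω, X ω)) P).comap Prod.swap measurable_swap := by
  refine condDistrib_ae_eq_of_measure_eq_compProd X (hC.prodMk hW).aemeasurable ?_
  set κ := condDistrib W (fun ω => (C ω, X ω)) P
  refine Measure.ext_of_lintegral _ fun f hf => ?_
  have hF : Measurable fun q : 𝒳 × 𝒞 => ∫⁻ w, f (q.1, (q.2, w)) ∂(κ q.swap) :=
    Measurable.lintegral_kernel_prod_right'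
      (κ := κ.comap Prod.swap measurable_swap) (f := fun r : (𝒳 × 𝒞) × 𝒲 => f (r.1.1, (r.1.2, r.2)))
      (hf.comp (by fun_prop))
  have hG : Measurable fun r : (𝒞 × 𝒳) × 𝒲 => f (r.1.2, (r.1.1, r.2)) := hf.comp (by fun_prop)
  rw [lintegral_map hf (by fun_prop), Measure.lintegral_compProd hf]
  have h1 : ∀ x, ∫⁻ p, f (x, p) ∂((condDistrib C X P ⊗ₖ κ.comap Prod.swap measurable_swap) x) =
      ∫⁻ c, ∫⁻ w, f (x, (c, w)) ∂(κ (c, x)) ∂(condDistrib C X P x) := fun x => by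
    exact Kernel.lintegral_compProd _ _ _ (hf.comp measurable_prodMk_left)
  simp_rw [h1]
  have h2 := Measure.lintegral_compProd (μ := P.map X) (κ := condDistrib C X P) hF
  rw [compProd_map_condDistrib hC.aemeasurable, lintegral_map hF (by fun_prop)] at h2
  have h3 := Measure.lintegral_compProd (μ := P.map fun ω => (C ω, X ω)) (κ := κ) hG
  rw [compProd_map_condDistrib hW.aemeasurable, lintegral_map hG (by fun_prop),
    lintegral_map (Measurable.lintegral_kernel_prod_right' (κ := κ) hG) (by fun_prop)] at h3
  exact h3.trans h2

/-- Conditioning on `X = x` and then on `C = c` is conditioning on `(C, X) = (c, x)`. -/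
lemma condDistrib_condDistrib_ae_eq (hX : Measurable X) (hT : Measurable T) {c : E → 𝒞}
    (hc : Measurable c) {w : E → 𝒲} (hw : Measurable w) :
    ∀ᵐ x ∂(P.map X), ∀ᵐ a ∂((condDistrib T X P x).map c),
      condDistrib (fun ω => w (T ω)) (fun ω => (c (T ω), X ω)) P (a, x) =
        condDistrib w c (condDistrib T X P x) a := by
  filter_upwards [condDistrib_prodMk_ae_eq_compProd (P := P) hX (hc.comp hT) (hw.comp hT),
    condDistrib_comp_ae_eq_map (P := P) (X := X) hT (hc.prodMk hw),
    condDistrib_comp_ae_eq_map (P := P) (X := X) hT hc] with x h1 h2 h3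
  set κ := condDistrib (fun ω => w (T ω)) (fun ω => (c (T ω), X ω)) P with hκ
  have hκx : Measurable fun a : 𝒞 => (a, x) := by fun_prop
  have key : (condDistrib T X P x).map (fun t => (c t, w t)) =
      (condDistrib T X P x).map c ⊗ₘ κ.comap (fun a => (a, x)) hκx := by
    rw [← h2, ← h3]
    refine h1.trans ?_
    refine Measure.ext_of_lintegral _ fun f hf => ?_
    rw [Kernel.lintegral_compProd _ _ _ hf, Measure.lintegral_compProd hf]
    rfl
  filter_upwards [condDistrib_ae_eq_of_measure_eq_compProd c hw.aemeasurable key] with a ha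
  rw [ha]
  rfl

lemma integrable_condDistrib_ae (hX : Measurable X) (hT : Measurable T) {w : E → ℝ}
    (hw : Measurable w) (hi : Integrable (fun ω => w (T ω)) P) :
    ∀ᵐ x ∂(P.map X), Integrable w (condDistrib T X P x) := by
  have : Integrable (fun p : 𝒳 × E => w p.2) (P.map fun ω => (X ω, T ω)) := by
    refine (integrable_map_measure (hw.comp measurable_snd).aestronglyMeasurable
      (hX.prodMk hT).aemeasurable).2 hi
  exact this.condDistrib_ae_map hT.aemeasurable

lemma indepFun_condDistrib_ae (hT : Measurable T) {a : E → 𝒞} (ha : Measurable a) {b : E → 𝒲}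
    (hb : Measurable b)
    (h : CondIndepGiven P (fun ω => a (T ω)) (fun ω => b (T ω)) X) :
    ∀ᵐ x ∂(P.map X), IndepFun a b (condDistrib T X P x) := by
  filter_upwards [h, condDistrib_comp_ae_eq_map (P := P) (X := X) hT (ha.prodMk hb),
    condDistrib_comp_ae_eq_map (P := P) (X := X) hT ha,
    condDistrib_comp_ae_eq_map (P := P) (X := X) hT hb] with x h0 h1 h2 h3
  rw [indepFun_iff_map_prod_eq_prod_map_map ha.aemeasurable hb.aemeasurable, ← h1, ← h2, ← h3]
  exact h0

end Transfer

/-! ### The vectors `(z', a)'` -/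

section SnocVec

variable {n : ℕ}

lemma snocVec_last (z : Euc n) (a : ℝ) : snocVec z a (Fin.last n) = a := by
  simp [snocVec]

lemma snocVec_castSucc (z : Euc n) (a : ℝ) (i : Fin n) : snocVec z a i.castSucc = z i := by
  simp [snocVec]

lemma inner_snocVec (z w : Euc n) (a b : ℝ) :
    inner ℝ (snocVec z a) (snocVec w b) = inner ℝ z w + a * b := by
  simp [PiLp.inner_apply, Fin.sum_univ_castSucc, snocVec_last, snocVec_castSucc, mul_comm]

lemma measurable_snocVec : Measurable fun p : Euc n × ℝ => snocVec p.1 p.2 := by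
  refine (PiLp.continuous_toLp 2 _).measurable.comp (measurable_pi_iff.2 fun i => ?_)
  refine Fin.lastCases ?_ (fun i => ?_) i
  · simpa using measurable_snd
  · simp only [Fin.snoc_castSucc]
    exact (PiLp.continuous_apply 2 (fun _ : Fin n => ℝ) i).measurable.comp measurable_fst

lemma norm_snocVec_one_pos (z : Euc n) : 0 < ‖snocVec z 1‖ := by
  rw [norm_pos_iff]
  intro h
  have := snocVec_last z 1
  rw [h] at this
  simp at this

end SnocVec

/-! ### Selection as a half-space event, and the regression formula -/

namespace TreatmentEffect.Model

variable {Ω : Type*} [MeasurableSpace Ω] {n k : ℕ} (M : Model Ω n k)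

lemma measurable_Γt : Measurable M.Γt :=
  measurable_snocVec.comp (M.measurable_Γ.prodMk M.measurable_Θ)

lemma measurable_snocVec_Z : Measurable fun ω => snocVec (M.Z ω) 1 :=
  measurable_snocVec.comp (M.measurable_Z.prodMk measurable_const)

lemma measurable_S : Measurable M.S :=
  (M.measurable_snocVec_Z.norm.inv).smul M.measurable_snocVec_Z

lemma measurable_Vt : Measurable M.Vt := M.measurable_V.div M.measurable_snocVec_Z.norm

lemma measurable_SV : Measurable M.SV := M.measurable_S.prodMk M.measurable_Vt

lemma measurable_Δ : Measurable M.Δ := M.measurable_Y1.sub M.measurable_Y0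

lemma measurable_D : Measurable M.D := by
  have h : Measurable fun ω => M.V ω - inner ℝ (M.Z ω) (M.Γ ω) - M.Θ ω :=
    (M.measurable_V.sub (M.measurable_Z.inner M.measurable_Γ)).sub M.measurable_Θ
  exact Measurable.ite (measurableSet_lt measurable_const h) measurable_const measurable_const

lemma measurable_Y : Measurable M.Y := M.measurable_Y0.add (M.measurable_Δ.mul M.measurable_D)

lemma measurable_Ysq : Measurable M.Ysq := M.measurable_Y.pow_const 2

lemma measurable_Ysigned : Measurable M.Ysigned :=
  ((M.measurable_D.const_mul 2).const_sub 1).mul M.measurable_Y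

lemma measurable_X : Measurable M.X :=
  Measurable.ite (M.measurable_D (measurableSet_singleton 1)) M.measurable_X1 M.measurable_X0

lemma norm_S (ω : Ω) : ‖M.S ω‖ = 1 := by
  rw [S, norm_smul, norm_inv, norm_norm, inv_mul_cancel₀ (norm_snocVec_one_pos _).ne']

/-- Dividing the selection inequality by `‖(Z', 1)‖ > 0` does not change it; this puts `D = 1` in
the form of a half-space in `Γ̃` with unit normal `S̃`. -/
lemma inner_S_Γt_lt_Vt_iff (ω : Ω) :
    inner ℝ (M.S ω) (M.Γt ω) < M.Vt ω ↔ M.V ω - inner ℝ (M.Z ω) (M.Γ ω) - M.Θ ω > 0 := by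
  rw [S, Vt, Γt, inner_smul_left, inner_snocVec, lt_div_iff₀ (norm_snocVec_one_pos _)]
  simp only [conj_trivial, one_mul]
  rw [mul_comm, ← mul_assoc, mul_inv_cancel₀ (norm_snocVec_one_pos _).ne', one_mul]
  constructor <;> intro h <;> linarith

lemma Θ_lt_V_iff (M : Model Ω 0 k) (ω : Ω) :
    M.Θ ω < M.V ω ↔ M.V ω - inner ℝ (M.Z ω) (M.Γ ω) - M.Θ ω > 0 := by
  have : inner ℝ (M.Z ω) (M.Γ ω) = 0 := by simp [PiLp.inner_apply]
  rw [this]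
  constructor <;> intro h <;> linarith

section Outcomes

variable {M} {ω : Ω}

lemma D_eq_one (h : M.V ω - inner ℝ (M.Z ω) (M.Γ ω) - M.Θ ω > 0) : M.D ω = 1 := if_pos h

lemma D_eq_zero (h : ¬ M.V ω - inner ℝ (M.Z ω) (M.Γ ω) - M.Θ ω > 0) : M.D ω = 0 := if_neg h

lemma Y_of_D_eq_one (h : M.D ω = 1) : M.Y ω = M.Y1 ω := by simp [Y, Δ, h]

lemma Y_of_D_eq_zero (h : M.D ω = 0) : M.Y ω = M.Y0 ω := by simp [Y, h]

lemma Ysq_of_D_eq_one (h : M.D ω = 1) : M.Ysq ω = M.Y1 ω ^ 2 := by simp [Ysq, Y_of_D_eq_one h]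

lemma Ysq_of_D_eq_zero (h : M.D ω = 0) : M.Ysq ω = M.Y0 ω ^ 2 := by simp [Ysq, Y_of_D_eq_zero h]

lemma Ysigned_of_D_eq_one (h : M.D ω = 1) : M.Ysigned ω = -M.Y1 ω := by
  simp [Ysigned, Y_of_D_eq_one h, h]; ring

lemma Ysigned_of_D_eq_zero (h : M.D ω = 0) : M.Ysigned ω = M.Y0 ω := by
  simp [Ysigned, Y_of_D_eq_zero h, h]

end Outcomes

/-- Without conditioning on covariates: `Γ̃` has a density, `(V, Z)` is independent of
`(Y0, Γ, Θ)` and of `(Y1, Γ, Θ)`, and the potential outcomes are square integrable. -/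
structure Unconditional (Q : Measure Ω) : Prop where
  abs_cont : Q.map M.Γt ≪ volume
  indep_Y0 : IndepFun (fun ω => (M.V ω, M.Z ω)) (fun ω => (M.Y0 ω, M.Γ ω, M.Θ ω)) Q
  indep_Y1 : IndepFun (fun ω => (M.V ω, M.Z ω)) (fun ω => (M.Y1 ω, M.Γ ω, M.Θ ω)) Q
  memLp_Y0 : MemLp M.Y0 2 Q
  memLp_Y1 : MemLp M.Y1 2 Q

section Regression

variable {M} {Q : Measure Ω} [IsProbabilityMeasure Q]

omit [IsProbabilityMeasure Q] in
lemma Unconditional.abs_cont_Θ (h : M.Unconditional Q) : Q.map M.Θ ≪ volume := by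
  have hlast : Measure.QuasiMeasurePreserving
      (fun γ : Euc (n + 1) => γ (Fin.last n)) volume volume :=
    (Measure.quasiMeasurePreserving_eval (fun _ : Fin (n + 1) => (volume : Measure ℝ))
      (Fin.last n)).comp (PiLp.volume_preserving_ofLp (Fin (n + 1))).quasiMeasurePreserving
  have hΘ : M.Θ = (fun γ : Euc (n + 1) => γ (Fin.last n)) ∘ M.Γt := by
    ext ω
    exact (snocVec_last _ _).symm
  rw [hΘ, ← Measure.map_map hlast.measurable M.measurable_Γt]
  exact (h.abs_cont.map hlast.measurable).trans hlast.absolutelyContinuous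

variable {𝒰 𝒞 : Type*} [MeasureSpace 𝒰] [StandardBorelSpace 𝒰] [Nonempty 𝒰]
  [SigmaFinite (volume : Measure 𝒰)] [MeasurableSpace 𝒞] {W : Ω → ℝ}

/-- Common source of the scalar and vector regressions: `c` and `u` select which functions of the
instruments and of the unobservables are used, `A` encodes the selection rule, and `(φ₀, φ₁)` the
outcome. -/
lemma Unconditional.condMean_eq (h : M.Unconditional Q) {c : ℝ × Euc n → 𝒞} (hc : Measurable c)
    {u : Euc n × ℝ → 𝒰} (hu : Measurable u)
    (hac : Q.map (fun ω => u (M.Γ ω, M.Θ ω)) ≪ volume)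
    {A : Set (𝒞 × 𝒰)} (hA : MeasurableSet A)
    (hAD : ∀ ω, (c (M.V ω, M.Z ω), u (M.Γ ω, M.Θ ω)) ∈ A ↔
      M.V ω - inner ℝ (M.Z ω) (M.Γ ω) - M.Θ ω > 0)
    {φ₀ φ₁ : ℝ → ℝ} (hφ₀ : Measurable φ₀) (hφ₁ : Measurable φ₁)
    (hi₀ : Integrable (fun ω => φ₀ (M.Y0 ω)) Q) (hi₁ : Integrable (fun ω => φ₁ (M.Y1 ω)) Q)
    (hone : ∀ ω, M.D ω = 1 → W ω = φ₁ (M.Y1 ω)) (hzero : ∀ ω, M.D ω = 0 → W ω = φ₀ (M.Y0 ω)) :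
    ∀ᵐ v ∂(Q.map fun ω => c (M.V ω, M.Z ω)), condMean Q W (fun ω => c (M.V ω, M.Z ω)) v =
      (∫ ω, φ₀ (M.Y0 ω) ∂Q) + ∫ γ in {γ | (v, γ) ∈ A},
        effectDensity Q (fun ω => φ₀ (M.Y0 ω)) (fun ω => φ₁ (M.Y1 ω))
          (fun ω => u (M.Γ ω, M.Θ ω)) γ := by
  refine condMean_of_indepFun (hu.comp (M.measurable_Γ.prodMk M.measurable_Θ)) hac
    (hc.comp (M.measurable_V.prodMk M.measurable_Z)) (hφ₀.comp M.measurable_Y0)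
    (hφ₁.comp M.measurable_Y1) hi₀ hi₁ ?_ ?_ hA (fun ω hω => hone ω (D_eq_one ((hAD ω).1 hω)))
    (fun ω hω => hzero ω (D_eq_zero fun h' => hω ((hAD ω).2 h')))
  · exact h.indep_Y0.comp hc (ψ := fun p : ℝ × Euc n × ℝ => (φ₀ p.1, u p.2)) (by fun_prop)
  · exact h.indep_Y1.comp hc (ψ := fun p : ℝ × Euc n × ℝ => (φ₁ p.1, u p.2)) (by fun_prop)

end Regression

end TreatmentEffect.Model

/-! ### The identities under a fixed law of the primitives -/

namespace TreatmentEffect.Model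

section FixedCovariates

variable {Ω : Type*} [MeasurableSpace Ω] {n k : ℕ} {M : Model Ω n k}
  {Q : Measure Ω} [IsProbabilityMeasure Q]

section Unobservables

variable {𝒰 : Type*} [MeasureSpace 𝒰] [SigmaFinite (volume : Measure 𝒰)] {U : Ω → 𝒰}

lemma Unconditional.variance_formula (h : M.Unconditional Q) (hU : Measurable U)
    (hac : Q.map U ≪ volume)
    (huncorr : ∀ᵐ u ∂(Q.map U), condMean Q (fun ω => M.Y0 ω * M.Δ ω) U u =
      condMean Q M.Y0 U u * condMean Q M.Δ U u)
    {cv : 𝒰 → ℝ} (hcv : ∀ᵐ u ∂(Q.map U), cv u = condVariance Q M.Δ U u) :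
    ∀ᵐ u, cv u * ((Q.map U).rnDeriv volume u).toReal =
      effectDensity Q (fun ω => M.Y0 ω ^ 2) (fun ω => M.Y1 ω ^ 2) U u +
      effectDensity Q M.Y0 M.Y1 U u * effectDensity Q M.Y0 (fun ω => -M.Y1 ω) U u /
        ((Q.map U).rnDeriv volume u).toReal := by
  have hvar := condVariance_sub_ae_eq hU M.measurable_Y0 M.measurable_Y1 h.memLp_Y0 h.memLp_Y1
    huncorr
  filter_upwards [ae_of_density_ne_zero hac (hvar.and hcv)] with u hu
  unfold effectDensity
  -- Where the density vanishes, every term is `0`, the quotient included since division by `0`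
  -- gives `0`.
  by_cases hf : ((Q.map U).rnDeriv volume u).toReal = 0
  · simp [hf]
  · obtain ⟨h1, h2⟩ := hu hf
    have h3 : condVariance Q M.Δ U u = _ := h1
    rw [h2, h3]
    field_simp

lemma Unconditional.variance_decomposition (h : M.Unconditional Q) (hU : Measurable U)
    (hac : Q.map U ≪ volume)
    {cv cm : 𝒰 → ℝ} (hcv : ∀ᵐ u ∂(Q.map U), cv u = condVariance Q M.Δ U u)
    (hcm : ∀ᵐ u ∂(Q.map U), cm u = condMean Q M.Δ U u) :
    Integrable (fun u => cv u * ((Q.map U).rnDeriv volume u).toReal) ∧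
    Integrable (fun u => (cm u - ∫ ω, M.Δ ω ∂Q) ^ 2 * ((Q.map U).rnDeriv volume u).toReal) ∧
    variance M.Δ Q = (∫ u, cv u * ((Q.map U).rnDeriv volume u).toReal) +
      ∫ u, (cm u - ∫ ω, M.Δ ω ∂Q) ^ 2 * ((Q.map U).rnDeriv volume u).toReal := by
  have hΔ : MemLp M.Δ 2 Q := h.memLp_Y1.sub h.memLp_Y0
  have hcm' : (fun u => (cm u - ∫ ω, M.Δ ω ∂Q) ^ 2) =ᵐ[Q.map U]
      fun u => (condMean Q M.Δ U u - ∫ ω, M.Δ ω ∂Q) ^ 2 := by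
    filter_upwards [hcm] with u hu
    rw [hu]
  refine ⟨(integrable_mul_density_iff hac).2 ((integrable_congr hcv).2
    (integrable_condVariance hU M.measurable_Δ hΔ)), (integrable_mul_density_iff hac
      (m := fun u => (cm u - ∫ ω, M.Δ ω ∂Q) ^ 2)).2 ((integrable_congr hcm').2
    (integrable_sq_condMean_sub hU hΔ _)), ?_⟩
  rw [integral_mul_density hac, integral_mul_density hac (fun u => (cm u - ∫ ω, M.Δ ω ∂Q) ^ 2),
    integral_congr_ae hcv, integral_congr_ae hcm']
  exact variance_eq_integral_condVariance_add hU M.measurable_Δ hΔ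

lemma effectDensity_ae_eq_zero_of_notMem_support [TopologicalSpace 𝒰] [HereditarilyLindelofSpace 𝒰]
    (hac : Q.map U ≪ volume) (W₀ W₁ : Ω → ℝ) :
    ∀ᵐ u, u ∉ (Q.map U).support → effectDensity Q W₀ W₁ U u = 0 := by
  filter_upwards [density_ae_eq_zero hac
    (p := fun u => u ∈ (Q.map U).support) Measure.support_mem_ae] with u hu h
  rw [effectDensity, hu h, mul_zero]

end Unobservables

section OutcomeIntegrability

lemma Unconditional.integrable_Y0 (h : M.Unconditional Q) : Integrable M.Y0 Q :=
  h.memLp_Y0.integrable (by norm_num)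

lemma Unconditional.integrable_Y1 (h : M.Unconditional Q) : Integrable M.Y1 Q :=
  h.memLp_Y1.integrable (by norm_num)

end OutcomeIntegrability

section Vector

lemma measurableSet_inner_lt (L : ℕ) :
    MeasurableSet {q : (Euc L × ℝ) × Euc L | inner ℝ q.1.1 q.2 < q.1.2} :=
  (isOpen_lt (by fun_prop) (by fun_prop)).measurableSet

lemma Unconditional.condMean_vector (h : M.Unconditional Q) {W : Ω → ℝ}
    {φ₀ φ₁ : ℝ → ℝ} (hφ₀ : Measurable φ₀) (hφ₁ : Measurable φ₁)
    (hi₀ : Integrable (fun ω => φ₀ (M.Y0 ω)) Q) (hi₁ : Integrable (fun ω => φ₁ (M.Y1 ω)) Q)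
    (hone : ∀ ω, M.D ω = 1 → W ω = φ₁ (M.Y1 ω)) (hzero : ∀ ω, M.D ω = 0 → W ω = φ₀ (M.Y0 ω)) :
    ∀ᵐ p ∂(Q.map M.SV), condMean Q W M.SV p = (∫ ω, φ₀ (M.Y0 ω) ∂Q) +
      ∫ γ in {γ | inner ℝ p.1 γ < p.2},
        effectDensity Q (fun ω => φ₀ (M.Y0 ω)) (fun ω => φ₁ (M.Y1 ω)) M.Γt γ := by
  have hZ : Measurable fun p : ℝ × Euc n => snocVec p.2 1 :=
    measurable_snocVec.comp (measurable_snd.prodMk measurable_const)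
  exact h.condMean_eq (W := W)
    (c := fun p => (‖snocVec p.2 1‖⁻¹ • snocVec p.2 1, p.1 / ‖snocVec p.2 1‖))
    ((hZ.norm.inv.smul hZ).prodMk (measurable_fst.div hZ.norm)) measurable_snocVec h.abs_cont
    (measurableSet_inner_lt (n + 1)) M.inner_S_Γt_lt_Vt_iff hφ₀ hφ₁ hi₀ hi₁ hone hzero

omit [IsProbabilityMeasure Q] in
lemma ae_norm_fst_eq_one : ∀ᵐ p ∂(Q.map M.SV), ‖p.1‖ = 1 := by
  rw [ae_map_iff M.measurable_SV.aemeasurable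
    (measurableSet_eq_fun (by fun_prop) measurable_const)]
  exact ae_of_all _ M.norm_S

/-- Under the large support condition, the vertical slices of the support of `(S̃, Ṽ)` contain all
the values between two values of `⟪s, γ⟫`, for `s` arbitrarily close to any given point. -/
lemma frequently_mem_slice (hsupp : (Q.map M.S).support = closure (upperHemisphere n))
    (hslice : ∀ᵐ s ∂(Q.map M.S),
      {v : ℝ | (⨅ γ ∈ (Q.map M.Γt).support, ((inner ℝ s γ : ℝ) : EReal)) ≤ v ∧
          (v : EReal) ≤ ⨆ γ ∈ (Q.map M.Γt).support, ((inner ℝ s γ : ℝ) : EReal)} ⊆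
        (condDistrib M.Vt M.S Q s).support)
    {s₀ : Euc (n + 1)} (hs₀ : s₀ ∈ upperHemisphere n) :
    ∃ᶠ s in 𝓝 s₀, ∀ γ₁ ∈ (Q.map M.Γt).support, ∀ γ₂ ∈ (Q.map M.Γt).support, ∀ v : ℝ,
      inner ℝ s γ₁ < v → v < inner ℝ s γ₂ → v ∈ slice (Q.map M.SV) s := by
  -- Disintegrating over `S̃`, almost every conditional law of `Ṽ` is carried by the slice of the
  -- joint support; the slice is closed, so it contains the support of that law.
  have h1 : ∀ᵐ s ∂(Q.map M.S), (condDistrib M.Vt M.S Q s).support ⊆ slice (Q.map M.SV) s := by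
    have : ∀ᵐ p ∂(Q.map M.S ⊗ₘ condDistrib M.Vt M.S Q), p ∈ (Q.map M.SV).support := by
      rw [compProd_map_condDistrib M.measurable_Vt.aemeasurable]
      exact Measure.support_mem_ae
    filter_upwards [Measure.ae_ae_of_ae_compProd this] with s hs
    exact Measure.support_subset_of_isClosed
      (Measure.isClosed_support.preimage (by fun_prop : Continuous fun v : ℝ => (s, v))) hs
  have hmem : s₀ ∈ (Q.map M.S).support := hsupp ▸ subset_closure hs₀
  rw [Filter.frequently_iff]
  intro N hN
  have hpos := (Measure.mem_support_iff_forall s₀).1 hmem N hN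
  by_contra! hcon
  refine hpos.ne' (measure_mono_null ?_ (hslice.and h1))
  intro s hs hgood
  obtain ⟨γ₁, hγ₁, γ₂, hγ₂, v, hv₁, hv₂, hv⟩ := hcon s hs
  refine hv (hgood.2 (hgood.1 ⟨?_, ?_⟩))
  · exact (iInf₂_le γ₁ hγ₁).trans (EReal.coe_le_coe_iff.2 hv₁.le)
  · exact (EReal.coe_le_coe_iff.2 hv₂.le).trans
      (le_iSup₂ (f := fun γ _ => ((inner ℝ s γ : ℝ) : EReal)) γ₂ hγ₂)

lemma Unconditional.effectDensity_eq_zero_off_slice (h : M.Unconditional Q)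
    (hfreq : ∀ s₀ ∈ upperHemisphere n, ∃ᶠ s in 𝓝 s₀, ∀ γ₁ ∈ (Q.map M.Γt).support,
      ∀ γ₂ ∈ (Q.map M.Γt).support, ∀ v : ℝ,
      inner ℝ s γ₁ < v → v < inner ℝ s γ₂ → v ∈ slice (Q.map M.SV) s) (W₀ W₁ : Ω → ℝ)
    {s : Euc (n + 1)} (hs : s ∈ upperHemisphere n) :
    ∀ᵐ γ, inner ℝ s γ ∈ (slice (Q.map M.SV) s)ᶜ → effectDensity Q W₀ W₁ M.Γt γ = 0 := by
  filter_upwards [ae_inner_mem_slice hs.1 (hfreq s hs),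
    effectDensity_ae_eq_zero_of_notMem_support h.abs_cont W₀ W₁] with γ h1 h2 hγ
  exact h2 fun hmem => hγ (h1 hmem)

lemma Unconditional.regression_vector (h : M.Unconditional Q)
    (hfreq : ∀ s₀ ∈ upperHemisphere n, ∃ᶠ s in 𝓝 s₀, ∀ γ₁ ∈ (Q.map M.Γt).support,
      ∀ γ₂ ∈ (Q.map M.Γt).support, ∀ v : ℝ,
      inner ℝ s γ₁ < v → v < inner ℝ s γ₂ → v ∈ slice (Q.map M.SV) s) {W : Ω → ℝ}
    {φ₀ φ₁ : ℝ → ℝ} (hφ₀ : Measurable φ₀) (hφ₁ : Measurable φ₁)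
    (hi₀ : Integrable (fun ω => φ₀ (M.Y0 ω)) Q) (hi₁ : Integrable (fun ω => φ₁ (M.Y1 ω)) Q)
    (hone : ∀ ω, M.D ω = 1 → W ω = φ₁ (M.Y1 ω)) (hzero : ∀ ω, M.D ω = 0 → W ω = φ₀ (M.Y0 ω))
    {m : Euc (n + 1) × ℝ → ℝ} (hm : ∀ᵐ p ∂(Q.map M.SV), m p = condMean Q W M.SV p) :
    HasPartialExt (Q.map M.SV) m ∧ IsRadonPreimage (partialExt (Q.map M.SV) m)
      (effectDensity Q (fun ω => φ₀ (M.Y0 ω)) (fun ω => φ₁ (M.Y1 ω)) M.Γt) := by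
  have hg := integrable_effectDensity M.measurable_Γt h.abs_cont hi₀ hi₁
  have hm' := hm.and (h.condMean_vector hφ₀ hφ₁ hi₀ hi₁ hone hzero)
  replace hm' := hm'.mono fun p hp => hp.1.trans hp.2
  exact ⟨hasPartialExt_of_ae_eq ae_norm_fst_eq_one hg hm',
    isRadonPreimage_partialExt ae_norm_fst_eq_one hg hm' fun s hs =>
      h.effectDensity_eq_zero_off_slice hfreq _ _ hs⟩

end Vector

section Scalar

variable {M : Model Ω 0 k}

lemma Unconditional.condMean_scalar (h : M.Unconditional Q) {W : Ω → ℝ}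
    {φ₀ φ₁ : ℝ → ℝ} (hφ₀ : Measurable φ₀) (hφ₁ : Measurable φ₁)
    (hi₀ : Integrable (fun ω => φ₀ (M.Y0 ω)) Q) (hi₁ : Integrable (fun ω => φ₁ (M.Y1 ω)) Q)
    (hone : ∀ ω, M.D ω = 1 → W ω = φ₁ (M.Y1 ω)) (hzero : ∀ ω, M.D ω = 0 → W ω = φ₀ (M.Y0 ω)) :
    ∀ᵐ v ∂(Q.map M.V), condMean Q W M.V v = (∫ ω, φ₀ (M.Y0 ω) ∂Q) +
      ∫ θ in Set.Iio v,
        effectDensity Q (fun ω => φ₀ (M.Y0 ω)) (fun ω => φ₁ (M.Y1 ω)) M.Θ θ :=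
  h.condMean_eq (W := W) (c := Prod.fst) measurable_fst (u := Prod.snd) measurable_snd
    h.abs_cont_Θ (A := {p | p.2 < p.1}) (measurableSet_lt measurable_snd measurable_fst)
    M.Θ_lt_V_iff hφ₀ hφ₁ hi₀ hi₁ hone hzero

lemma Unconditional.regression_scalar (h : M.Unconditional Q) {W : Ω → ℝ}
    {φ₀ φ₁ : ℝ → ℝ} (hφ₀ : Measurable φ₀) (hφ₁ : Measurable φ₁)
    (hi₀ : Integrable (fun ω => φ₀ (M.Y0 ω)) Q) (hi₁ : Integrable (fun ω => φ₁ (M.Y1 ω)) Q)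
    (hone : ∀ ω, M.D ω = 1 → W ω = φ₁ (M.Y1 ω)) (hzero : ∀ ω, M.D ω = 0 → W ω = φ₀ (M.Y0 ω))
    {m : ℝ → ℝ} (hm : ∀ᵐ v ∂(Q.map M.V), m v = condMean Q W M.V v) :
    HasDerivExt (Q.map M.V) m ∧ ∀ᵐ v, v ∈ (Q.map M.V).support → derivExt (Q.map M.V) m v =
      effectDensity Q (fun ω => φ₀ (M.Y0 ω)) (fun ω => φ₁ (M.Y1 ω)) M.Θ v := by
  have hg := integrable_effectDensity M.measurable_Θ h.abs_cont_Θ hi₀ hi₁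
  have hm' := hm.and (h.condMean_scalar hφ₀ hφ₁ hi₀ hi₁ hone hzero)
  replace hm' := hm'.mono fun p hp => hp.1.trans hp.2
  exact ⟨hasDerivExt_of_ae_eq hg hm', derivExt_ae_eq hg hm'⟩

end Scalar

end FixedCovariates

end TreatmentEffect.Model

/-! ### Reduction to the law of the primitives given the covariates -/

namespace TreatmentEffect

/-- The space of the values of `(Y0, Y1, V, Z, Γ, Θ)`. -/
abbrev Primitives (n : ℕ) : Type := ℝ × ℝ × ℝ × Euc n × Euc n × ℝ

/-- The model whose primitive random variables are the coordinates. -/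
noncomputable def coordModel (n k : ℕ) : Model (Primitives n) n k where
  Y0 := fun t => t.1
  Y1 := fun t => t.2.1
  V := fun t => t.2.2.1
  Z := fun t => t.2.2.2.1
  Γ := fun t => t.2.2.2.2.1
  Θ := fun t => t.2.2.2.2.2
  X0 := fun _ => 0
  X1 := fun _ => 0
  measurable_Y0 := by fun_prop
  measurable_Y1 := by fun_prop
  measurable_V := by fun_prop
  measurable_Z := by fun_prop
  measurable_Γ := by fun_prop
  measurable_Θ := by fun_prop
  measurable_X0 := by fun_prop
  measurable_X1 := by fun_prop

namespace Model

variable {Ω : Type*} [MeasurableSpace Ω] {n k : ℕ} (M : Model Ω n k)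

/-- The vector `(Y0, Y1, V, Z, Γ, Θ)`. -/
def prim (ω : Ω) : Primitives n := (M.Y0 ω, M.Y1 ω, M.V ω, M.Z ω, M.Γ ω, M.Θ ω)

lemma measurable_prim : Measurable M.prim :=
  M.measurable_Y0.prodMk (M.measurable_Y1.prodMk (M.measurable_V.prodMk (M.measurable_Z.prodMk
    (M.measurable_Γ.prodMk M.measurable_Θ))))

variable (P : Measure Ω) [IsProbabilityMeasure P]

/-- The law of `(Y0, Y1, V, Z, Γ, Θ)` given `X = x`. -/
noncomputable abbrev primLaw (x : Euc k) : Measure (Primitives n) := condDistrib M.prim M.X P x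

variable {M P}

lemma condDistrib_prim {𝒲 : Type*} [MeasurableSpace 𝒲] [StandardBorelSpace 𝒲] [Nonempty 𝒲]
    {w : Primitives n → 𝒲} (hw : Measurable w) :
    ∀ᵐ x ∂(P.map M.X), condDistrib (fun ω => w (M.prim ω)) M.X P x = (M.primLaw P x).map w :=
  condDistrib_comp_ae_eq_map M.measurable_prim hw

section Conditioning

variable {𝒞 : Type*} [MeasurableSpace 𝒞] [StandardBorelSpace 𝒞] [Nonempty 𝒞]

lemma condMean_prim {c : Primitives n → 𝒞} (hc : Measurable c) {w : Primitives n → ℝ}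
    (hw : Measurable w) :
    ∀ᵐ x ∂(P.map M.X), ∀ᵐ a ∂((M.primLaw P x).map c),
      condMean P (fun ω => w (M.prim ω)) (fun ω => (c (M.prim ω), M.X ω)) (a, x) =
        condMean (M.primLaw P x) w c a := by
  filter_upwards [condDistrib_condDistrib_ae_eq (P := P) M.measurable_X M.measurable_prim hc hw]
    with x hx
  filter_upwards [hx] with a ha
  rw [condMean, ha, condMean]

lemma condVariance_prim {c : Primitives n → 𝒞} (hc : Measurable c) {w : Primitives n → ℝ}
    (hw : Measurable w) :
    ∀ᵐ x ∂(P.map M.X), ∀ᵐ a ∂((M.primLaw P x).map c),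
      condVariance P (fun ω => w (M.prim ω)) (fun ω => (c (M.prim ω), M.X ω)) (a, x) =
        condVariance (M.primLaw P x) w c a := by
  filter_upwards [condDistrib_condDistrib_ae_eq (P := P) M.measurable_X M.measurable_prim hc hw]
    with x hx
  filter_upwards [hx] with a ha
  rw [condVariance, ha, condVariance]

end Conditioning

omit [IsProbabilityMeasure P] in
lemma Uncorrelated.memLp_Y0 (h : M.Uncorrelated P) : MemLp M.Y0 2 P :=
  (memLp_two_iff_integrable_sq M.measurable_Y0.aestronglyMeasurable).2 <|
    h.second_moments.mono' (M.measurable_Y0.pow_const 2).aestronglyMeasurable <|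
      ae_of_all _ fun ω => by
        rw [Real.norm_of_nonneg (sq_nonneg _)]
        exact le_add_of_nonneg_right (sq_nonneg _)

omit [IsProbabilityMeasure P] in
lemma Uncorrelated.memLp_Y1 (h : M.Uncorrelated P) : MemLp M.Y1 2 P :=
  (memLp_two_iff_integrable_sq M.measurable_Y1.aestronglyMeasurable).2 <|
    h.second_moments.mono' (M.measurable_Y1.pow_const 2).aestronglyMeasurable <|
      ae_of_all _ fun ω => by
        rw [Real.norm_of_nonneg (sq_nonneg _)]
        exact le_add_of_nonneg_left (sq_nonneg _)

lemma memLp_primLaw {w : Primitives n → ℝ} (hw : Measurable w)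
    (h : MemLp (fun ω => w (M.prim ω)) 2 P) :
    ∀ᵐ x ∂(P.map M.X), MemLp w 2 (M.primLaw P x) := by
  filter_upwards [integrable_condDistrib_ae (P := P) M.measurable_X M.measurable_prim
    (hw.pow_const 2) h.integrable_sq] with x hx
  exact (memLp_two_iff_integrable_sq hw.aestronglyMeasurable).2 hx

lemma unconditional_primLaw (hbasic : M.BasicAssumptions P) (h : M.Uncorrelated P) :
    ∀ᵐ x ∂(P.map M.X), (coordModel n k).Unconditional (M.primLaw P x) := by
  let N := coordModel n k
  filter_upwards [hbasic.abs_cont,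
    condDistrib_prim (M := M) (P := P) (N.measurable_SV.prodMk N.measurable_Γt),
    indepFun_condDistrib_ae (P := P) (X := M.X) M.measurable_prim
      (N.measurable_V.prodMk N.measurable_Z)
      (N.measurable_Y0.prodMk (N.measurable_Γ.prodMk N.measurable_Θ)) hbasic.indep_Y0,
    indepFun_condDistrib_ae (P := P) (X := M.X) M.measurable_prim
      (N.measurable_V.prodMk N.measurable_Z)
      (N.measurable_Y1.prodMk (N.measurable_Γ.prodMk N.measurable_Θ)) hbasic.indep_Y1,
    memLp_primLaw N.measurable_Y0 h.memLp_Y0, memLp_primLaw N.measurable_Y1 h.memLp_Y1]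
    with x h1 h2 h3 h4 h5 h6
  refine ⟨?_, h3, h4, h5, h6⟩
  have h7 : (M.primLaw P x).map (fun t => (N.SV t, N.Γt t)) ≪
      ((sphereMeasure (n + 1)).prod (volume : Measure ℝ)).prod volume := h2 ▸ h1
  have h8 := (h7.map measurable_snd).trans Measure.quasiMeasurePreserving_snd.absolutelyContinuous
  rwa [Measure.map_map measurable_snd (N.measurable_SV.prodMk N.measurable_Γt)] at h8

/-- The map `u` has a measurable left inverse, so `(u(Γ, Θ), X)` generates the same σ-algebra as
`(Γ, Θ, X)`. The assumption then becomes an identity of conditional means, which is carried to the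
law given `X = x`. -/
lemma uncorr_primLaw (h : M.Uncorrelated P) {𝒰 : Type*} [MeasurableSpace 𝒰]
    [StandardBorelSpace 𝒰] [Nonempty 𝒰] {u : Euc n × ℝ → 𝒰} (hu : Measurable u)
    {u' : 𝒰 → Euc n × ℝ} (hu' : Measurable u') (hleft : ∀ p, u' (u p) = p) :
    ∀ᵐ x ∂(P.map M.X), ∀ᵐ a ∂((M.primLaw P x).map fun t => u (t.2.2.2.2.1, t.2.2.2.2.2)),
      condMean (M.primLaw P x) (fun t => (coordModel n k).Y0 t * (coordModel n k).Δ t)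
          (fun t => u (t.2.2.2.2.1, t.2.2.2.2.2)) a =
        condMean (M.primLaw P x) (coordModel n k).Y0 (fun t => u (t.2.2.2.2.1, t.2.2.2.2.2)) a *
          condMean (M.primLaw P x) (coordModel n k).Δ
            (fun t => u (t.2.2.2.2.1, t.2.2.2.2.2)) a := by
  let N := coordModel n k
  have hc : Measurable fun t : Primitives n => u (t.2.2.2.2.1, t.2.2.2.2.2) :=
    hu.comp (by fun_prop)
  set c := fun t : Primitives n => u (t.2.2.2.2.1, t.2.2.2.2.2) with hc_def
  have hcX : Measurable fun ω => (c (M.prim ω), M.X ω) :=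
    (hc.comp M.measurable_prim).prodMk M.measurable_X
  have hσ : M.sigmaUnobs = MeasurableSpace.comap (fun ω => (c (M.prim ω), M.X ω)) inferInstance := by
    refine le_antisymm ?_ ?_
    · refine Measurable.comap_le ?_
      have : (fun ω => (M.Γ ω, M.Θ ω, M.X ω)) =
          (fun p : 𝒰 × Euc k => ((u' p.1).1, (u' p.1).2, p.2)) ∘
            fun ω => (c (M.prim ω), M.X ω) := by
        ext1 ω
        simp only [hc_def, prim, Function.comp_apply, hleft]
      rw [this]
      exact Measurable.comp (by fun_prop) (comap_measurable _)
    · refine Measurable.comap_le ?_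
      have : (fun ω => (c (M.prim ω), M.X ω)) =
          (fun p : Euc n × ℝ × Euc k => (u (p.1, p.2.1), p.2.2)) ∘
            fun ω => (M.Γ ω, M.Θ ω, M.X ω) := rfl
      rw [this]
      exact Measurable.comp (by fun_prop) (comap_measurable _)
  have hΔ : MemLp M.Δ 2 P := h.memLp_Y1.sub h.memLp_Y0
  have hae := h.uncorr
  rw [hσ] at hae
  have hP : ∀ᵐ q ∂(P.map fun ω => (c (M.prim ω), M.X ω)),
      condMean P (fun ω => M.Y0 ω * M.Δ ω) (fun ω => (c (M.prim ω), M.X ω)) q =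
        condMean P M.Y0 (fun ω => (c (M.prim ω), M.X ω)) q *
          condMean P M.Δ (fun ω => (c (M.prim ω), M.X ω)) q := by
    refine (ae_map_iff hcX.aemeasurable (measurableSet_eq_fun (measurable_condMean _ _)
      ((measurable_condMean _ _).mul (measurable_condMean _ _)))).2 ?_
    filter_upwards [hae, condExp_ae_eq_condMean hcX (h.memLp_Y0.integrable_mul hΔ),
      condExp_ae_eq_condMean hcX (h.memLp_Y0.integrable (by norm_num)),
      condExp_ae_eq_condMean hcX (hΔ.integrable (by norm_num))] with ω h1 h2 h3 h4
    rw [Pi.mul_apply, ← h3, ← h4, ← h1]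
    exact h2.symm
  filter_upwards [ae_ae_condDistrib_of_ae_map M.measurable_X (hc.comp M.measurable_prim) hP,
    condDistrib_prim (M := M) (P := P) hc,
    condMean_prim (M := M) (P := P) hc (N.measurable_Y0.mul N.measurable_Δ),
    condMean_prim (M := M) (P := P) hc N.measurable_Y0,
    condMean_prim (M := M) (P := P) hc N.measurable_Δ] with x h1 h2 h3 h4 h5
  have h1' : ∀ᵐ a ∂((M.primLaw P x).map c), _ := h2 ▸ h1
  filter_upwards [h1', h3, h4, h5] with a e1 e2 e3 e4
  rw [← e3, ← e4]
  exact e2.symm.trans e1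

/-- The law of total variance under the law given `X = x`. Conditional moments given `(U, X)` match
those of that law only up to null sets of `U`, which the density does not see. -/
lemma varianceDecomposition_primLaw (hbasic : M.BasicAssumptions P) (h : M.Uncorrelated P)
    {𝒰 : Type*} [MeasureSpace 𝒰] [SigmaFinite (volume : Measure 𝒰)]
    [StandardBorelSpace 𝒰] [Nonempty 𝒰] {u : Primitives n → 𝒰} (hu : Measurable u)
    (hac : ∀ᵐ x ∂(P.map M.X), (M.primLaw P x).map u ≪ volume) :
    ∀ᵐ x ∂(P.map M.X), M.VarianceDecomposition P (fun ω => u (M.prim ω)) x := by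
  let N := coordModel n k
  filter_upwards [hac, unconditional_primLaw hbasic h, condDistrib_prim (M := M) (P := P) hu,
    condDistrib_prim (M := M) (P := P) N.measurable_Δ,
    condMean_prim (M := M) (P := P) hu N.measurable_Δ,
    condVariance_prim (M := M) (P := P) hu N.measurable_Δ] with x h1 h2 h3 h4 h5 h6
  have hATE : M.ATE P x = ∫ t, N.Δ t ∂(M.primLaw P x) := by
    have : M.ATE P x = ∫ w, w ∂((M.primLaw P x).map N.Δ) := by rw [← h4]; rfl
    rw [this]
    exact integral_map N.measurable_Δ.aemeasurable aestronglyMeasurable_id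
  have hvar : condVariance P M.Δ M.X x = variance N.Δ (M.primLaw P x) := by
    have : condVariance P M.Δ M.X x = variance (fun w : ℝ => w) ((M.primLaw P x).map N.Δ) := by
      rw [← h4]; rfl
    rw [this]
    exact variance_id_map N.measurable_Δ.aemeasurable
  have := h2.variance_decomposition hu h1 h6 h5
  unfold VarianceDecomposition condDensity
  rw [h3, hATE, hvar]
  exact this

end Model

end TreatmentEffect

/-! ### Assembling the scalar and vector cases -/

namespace TreatmentEffect.Model

variable {Ω : Type*} [MeasurableSpace Ω] {n k : ℕ} {P : Measure Ω} [IsProbabilityMeasure P]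

/-- The last clause covers points outside both supports, where derivatives and density are all `0`.
Large support is what leaves no other points off the support of `V`. -/
lemma scalar_ae {M : Model Ω 0 k} (hbasic : M.BasicAssumptions P) (h : M.Uncorrelated P) :
    ∀ᵐ x ∂(P.map M.X),
      (M.DvScalarExists P M.Ysq x ∧ M.DvScalarExists P M.Y x ∧ M.DvScalarExists P M.Ysigned x ∧
        ∀ᵐ θ : ℝ, θ ∈ (condDistrib M.V M.X P x).support → M.VarianceFormulaScalar P x θ) ∧
      ∀ᵐ θ : ℝ, θ ∉ (condDistrib M.V M.X P x).support → θ ∉ (condDistrib M.Θ M.X P x).support →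
        M.VarianceFormulaScalar P x θ := by
  let N := coordModel 0 k
  filter_upwards [unconditional_primLaw hbasic h,
    condDistrib_prim (M := M) (P := P) N.measurable_V,
    condDistrib_prim (M := M) (P := P) N.measurable_Θ,
    condMean_prim (M := M) (P := P) N.measurable_V N.measurable_Ysq,
    condMean_prim (M := M) (P := P) N.measurable_V N.measurable_Y,
    condMean_prim (M := M) (P := P) N.measurable_V N.measurable_Ysigned,
    condVariance_prim (M := M) (P := P) N.measurable_Θ N.measurable_Δ,
    uncorr_primLaw h (u := Prod.snd) measurable_snd (u' := fun θ => (0, θ)) (by fun_prop)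
      (fun p => Prod.ext (Subsingleton.elim _ _) rfl)]
    with x hQ hV hΘ hsq hY hsg hcv hun
  have i₀ := hQ.integrable_Y0
  have i₁ := hQ.integrable_Y1
  obtain ⟨a1, b1⟩ := hQ.regression_scalar (φ₀ := fun y => y ^ 2) (φ₁ := fun y => y ^ 2)
    (by fun_prop) (by fun_prop) hQ.memLp_Y0.integrable_sq hQ.memLp_Y1.integrable_sq
    (fun _ => Ysq_of_D_eq_one) (fun _ => Ysq_of_D_eq_zero) hsq
  obtain ⟨a2, b2⟩ := hQ.regression_scalar (φ₀ := fun y => y) (φ₁ := fun y => y)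
    (by fun_prop) (by fun_prop) i₀ i₁ (fun _ => Y_of_D_eq_one) (fun _ => Y_of_D_eq_zero) hY
  obtain ⟨a3, b3⟩ := hQ.regression_scalar (φ₀ := fun y => y) (φ₁ := fun y => -y)
    (by fun_prop) (by fun_prop) i₀ i₁.neg (fun _ => Ysigned_of_D_eq_one)
    (fun _ => Ysigned_of_D_eq_zero) hsg
  have hform := hQ.variance_formula N.measurable_Θ hQ.abs_cont_Θ hun hcv
  have hzero := density_ae_eq_zero hQ.abs_cont_Θ
    (p := fun θ => θ ∈ ((M.primLaw P x).map N.Θ).support) Measure.support_mem_ae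
  -- The variables of `M` are by definition those of `N` composed with `M.prim`.
  have hV' : condDistrib M.V M.X P x = (M.primLaw P x).map N.V := hV
  have hΘ' : condDistrib M.Θ M.X P x = (M.primLaw P x).map N.Θ := hΘ
  unfold DvScalarExists VarianceFormulaScalar dvScalar condDensity
  rw [hV', hΘ']
  refine ⟨⟨a1, a2, a3, ?_⟩, ?_⟩
  · filter_upwards [hform, b1, b2, b3] with θ h1 h2 h3 h4 hθ
    erw [h2 hθ, h3 hθ, h4 hθ]
    exact h1
  · filter_upwards [hzero] with θ h1 hθ hθ'
    rw [h1 hθ']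
    simp [derivExt, hθ]

lemma vector_ae {M : Model Ω n k} (hbasic : M.BasicAssumptions P) (h : M.Uncorrelated P)
    (hlarge : M.LargeSupportVector P) :
    ∀ᵐ x ∂(P.map M.X),
      (M.DvVectorExists P M.Ysq x ∧ InRadonRange (M.dvVector P M.Ysq x)) ∧
      (M.DvVectorExists P M.Y x ∧ InRadonRange (M.dvVector P M.Y x)) ∧
      (M.DvVectorExists P M.Ysigned x ∧ InRadonRange (M.dvVector P M.Ysigned x)) ∧
      ∀ᵐ γ : Euc (n + 1), M.VarianceFormulaVector P x γ := by
  let N := coordModel n k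
  filter_upwards [unconditional_primLaw hbasic h, hlarge,
    condDistrib_prim (M := M) (P := P) N.measurable_S,
    condDistrib_prim (M := M) (P := P) N.measurable_SV,
    condDistrib_prim (M := M) (P := P) N.measurable_Γt,
    condDistrib_condDistrib_ae_eq (P := P) M.measurable_X M.measurable_prim N.measurable_S
      N.measurable_Vt,
    condMean_prim (M := M) (P := P) N.measurable_SV N.measurable_Ysq,
    condMean_prim (M := M) (P := P) N.measurable_SV N.measurable_Y,
    condMean_prim (M := M) (P := P) N.measurable_SV N.measurable_Ysigned,
    condVariance_prim (M := M) (P := P) N.measurable_Γt N.measurable_Δ,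
    uncorr_primLaw h (u := fun p => snocVec p.1 p.2) measurable_snocVec
      (u' := fun γ => (WithLp.toLp 2 fun i => γ i.castSucc, γ (Fin.last n))) (by fun_prop)
      (fun p => by
        refine Prod.ext ?_ (snocVec_last _ _)
        ext i
        exact snocVec_castSucc _ _ _)]
    with x hQ hL hS hSV hΓ hVS hsq hY hsg hcv hun
  have hS' : condDistrib M.S M.X P x = (M.primLaw P x).map N.S := hS
  have hSV' : condDistrib M.SV M.X P x = (M.primLaw P x).map N.SV := hSV
  have hΓ' : condDistrib M.Γt M.X P x = (M.primLaw P x).map N.Γt := hΓ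
  rw [hS', hΓ'] at hL
  -- Large support concerns the law of `Ṽ` given `(S̃, X) = (s, x)`; by conditioning in two stages
  -- it is the law of `Ṽ` given `S̃ = s` under the law given `X = x`.
  have hfreq := fun s₀ (hs₀ : s₀ ∈ upperHemisphere n) => frequently_mem_slice hL.1
    (by
      filter_upwards [hL.2, hVS] with s h1 h2
      have h2' : condDistrib M.Vt (fun ω => (M.S ω, M.X ω)) P (s, x) =
        condDistrib N.Vt N.S (M.primLaw P x) s := h2
      rwa [h2'] at h1) hs₀
  have i₀ := hQ.integrable_Y0
  have i₁ := hQ.integrable_Y1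
  obtain ⟨a1, b1⟩ := hQ.regression_vector hfreq (φ₀ := fun y => y ^ 2) (φ₁ := fun y => y ^ 2)
    (by fun_prop) (by fun_prop) hQ.memLp_Y0.integrable_sq hQ.memLp_Y1.integrable_sq
    (fun _ => Ysq_of_D_eq_one) (fun _ => Ysq_of_D_eq_zero) hsq
  obtain ⟨a2, b2⟩ := hQ.regression_vector hfreq (φ₀ := fun y => y) (φ₁ := fun y => y)
    (by fun_prop) (by fun_prop) i₀ i₁ (fun _ => Y_of_D_eq_one) (fun _ => Y_of_D_eq_zero) hY
  obtain ⟨a3, b3⟩ := hQ.regression_vector hfreq (φ₀ := fun y => y) (φ₁ := fun y => -y)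
    (by fun_prop) (by fun_prop) i₀ i₁.neg (fun _ => Ysigned_of_D_eq_one)
    (fun _ => Ysigned_of_D_eq_zero) hsg
  have hform := hQ.variance_formula N.measurable_Γt hQ.abs_cont hun hcv
  unfold DvVectorExists VarianceFormulaVector dvVector condDensity
  rw [hSV', hΓ']
  refine ⟨⟨a1, _, b1⟩, ⟨a2, _, b2⟩, ⟨a3, _, b3⟩, ?_⟩
  filter_upwards [hform, radonInv_ae_eq b1, radonInv_ae_eq b2, radonInv_ae_eq b3]
    with γ h1 h2 h3 h4
  erw [h2, h3, h4]
  exact h1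

end TreatmentEffect.Model

theorem theorem4 {Ω : Type*} [MeasurableSpace Ω] (P : Measure Ω) [IsProbabilityMeasure P]
    (n k : ℕ) (M : Model Ω n k)
    (hbasic : M.BasicAssumptions P) (huncorr : M.Uncorrelated P) :
    -- one unobservable in the selection equation, `L = n + 1 = 1`
    (n = 0 →
      (∀ᵐ x ∂(P.map M.X),
        M.DvScalarExists P M.Ysq x ∧ M.DvScalarExists P M.Y x ∧
        M.DvScalarExists P M.Ysigned x ∧
        ∀ᵐ θ : ℝ, θ ∈ (condDistrib M.V M.X P x).support → M.VarianceFormulaScalar P x θ) ∧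
      (M.LargeSupportScalar P →
        ∀ᵐ x ∂(P.map M.X),
          (∀ᵐ θ : ℝ, M.VarianceFormulaScalar P x θ) ∧
          M.VarianceDecomposition P M.Θ x)) ∧
    -- several unobservables, `L = n + 1 ≥ 2`
    (1 ≤ n → M.LargeSupportVector P →
      ∀ᵐ x ∂(P.map M.X),
        (M.DvVectorExists P M.Ysq x ∧ InRadonRange (M.dvVector P M.Ysq x)) ∧
        (M.DvVectorExists P M.Y x ∧ InRadonRange (M.dvVector P M.Y x)) ∧
        (M.DvVectorExists P M.Ysigned x ∧ InRadonRange (M.dvVector P M.Ysigned x)) ∧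
        (∀ᵐ γ : Euc (n + 1), M.VarianceFormulaVector P x γ) ∧
        M.VarianceDecomposition P M.Γt x) := by
  refine ⟨?_, fun _ hlarge => ?_⟩
  · rintro rfl
    refine ⟨(Model.scalar_ae hbasic huncorr).mono fun x hx => hx.1, fun hlarge => ?_⟩
    have hdec := Model.varianceDecomposition_primLaw hbasic huncorr
      (coordModel 0 k).measurable_Θ
      ((Model.unconditional_primLaw hbasic huncorr).mono fun x hx => hx.abs_cont_Θ)
    filter_upwards [Model.scalar_ae hbasic huncorr, hdec, hlarge] with x h1 h2 h3
    refine ⟨?_, h2⟩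
    filter_upwards [h1.1.2.2.2, h1.2] with θ e1 e2
    by_cases hθ : θ ∈ (condDistrib M.V M.X P x).support
    · exact e1 hθ
    · exact e2 hθ fun hmem => hθ (h3 hmem)
  · have hdec := Model.varianceDecomposition_primLaw hbasic huncorr
      (coordModel n k).measurable_Γt
      ((Model.unconditional_primLaw hbasic huncorr).mono fun x hx => hx.abs_cont)
    filter_upwards [Model.vector_ae hbasic huncorr hlarge, hdec] with x h1 h2
    exact ⟨h1.1, h1.2.1, h1.2.2.1, h1.2.2.2, h2⟩
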